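/- Notation: $dA=\pi^{-1}dx\,dy$ on $\mathbb{C}$; $\partial=\frac12(\partial_x-i\partial_y)$, $\bar\partial=\frac12(\partial_x+i\partial_y)$, $\Delta=\partial\bar\partial$; $\mathbb{D}(a,\rho)$ is the open disk of centre $a$ and radius $\rho$. For an open set $U\subset\mathbb C$, a function $f$ is $q$-analytic on $U$ if it is continuous on $U$ and $\bar\partial^q f=0$ there in the sense of distributions. Let $Q:\mathbb{C}\to\mathbb{R}$ be continuous, let $z_0\in\mathbb{C}$, and suppose that $Q$ is real-analytic near $z_0$ and $\Delta Q(z_0)>0$. For $q\ge 1$ and real $m\ge1$ let $A^2_{q,mQ}$ be the space of functions $u$ that are $q$-analytic on $\mathbb{C}$ with $\|u\|_m^2=\int_{\mathbb{C}}|u|^2e^{-mQ}\,dA<\infty$. Call $r>0$, together with a function $Q(\cdot,\cdot)$ on $\mathbb{D}(z_0,r)^2$, admissible if: (1) $Q$ is real-analytic on $\mathbb{D}(z_0,r)$ and $\Delta Q>\epsilon$ there for some $\epsilon>0$; (2) $Q(z,w)$ is a polarization of $Q$, i.e. it is analytic in $z$ and anti-analytic in $w$ (holomorphic in $(z,\bar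 w)$), and $Q(z,z)=Q(z)$; (3) $\partial_z\bar\partial_wQ(z,w)\ne0$ and $\bar\partial_w\theta(z,w)\neq0$ for $z,w\in\mathbb{D}(z_0,r)$, where $\theta(z,w)=\frac{Q(w)-Q(z,w)}{w-z}$ for $w\ne z$ and $\theta(z,z)=\partial Q(z)$; (4) $2\operatorname{Re}Q(z,w)-Q(w)-Q(z)\le-\frac12\Delta Q(z_0)|w-z|^2$ for $z,w\in\mathbb{D}(z_0,r)$. Then all sufficiently small $r>0$ are admissible with a suitable polarization. Moreover, let $r$ and $Q(\cdot,\cdot)$ be admissible, let $q\ge1$ be an integer, and for real $m\ge 1$ put \[ R_{q,m}(z,w)=m\sum_{k=0}^{q-1}\frac{q!\,(-1)^k}{(q-1-k)!\,(k+1)!\,k!}(\bar z-\bar w)^k\,\bar\partial_w^k\big(\bar\partial_w\theta\, e^{m(z-w)\theta}\big)e^{-m(z-w)\theta},\qquad z,w\in\mathbb{D}(z_0,r). \] Then $R_{q,m}$ is $q$-analytic in $z$ and real-analytic in $w$ on $\mathbb{D}(z_0,r)$. Finally, let $\chi(w)=\chi_0(|w-z_0|/r)$, where $\chi_0:\mathbb{R}\to[0,\infty)$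 is smooth, equals $1$ on $(-\frac23,\frac23)$ and has (closed) support in $(-1,1)$. Then there are $\delta>0$ and $C>0$, independent of $m$, $u$ and $z$, such that for all real $m\ge1$, all $u\in A^2_{q,mQ}$ and all $z\in\mathbb{D}(z_0,\frac13r)$ the integral below converges absolutely and \[ \Big|u(z)-\int_{\mathbb{D}(z_0,r)}u(w)\chi(w)R_{q,m}(z,w)e^{m(z-w)\theta(z,w)}\,dA(w)\Big|\le C\,\|u\|_m\,e^{mQ(z)/2-\delta m}. \] -/

import Mathlib

open MeasureTheory Set
open scoped ContDiff ComplexConjugate Nat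

noncomputable section

namespace Polyanalytic

/-- The normalized area measure `dA = π⁻¹ dx dy` on the complex plane. -/
def area : Measure ℂ := ENNReal.ofReal Real.pi⁻¹ • volume

/-- The Wirtinger derivative `∂ = (∂_x - i ∂_y) / 2`. -/
def dz (f : ℂ → ℂ) (z : ℂ) : ℂ :=
  (fderiv ℝ f z 1 - Complex.I * fderiv ℝ f z Complex.I) / 2

/-- The Wirtinger derivative `∂̄ = (∂_x + i ∂_y) / 2`. -/
def dbar (f : ℂ → ℂ) (z : ℂ) : ℂ :=
  (fderiv ℝ f z 1 + Complex.I * fderiv ℝ f z Complex.I) / 2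

/-- `Δ = ∂ ∂̄` (one quarter of the usual Laplacian), on real-valued functions. -/
def lap (Q : ℂ → ℝ) (z : ℂ) : ℝ := (dz (dbar fun w => (Q w : ℂ)) z).re

/-- `f` is `q`-analytic on `U`: continuous, with `∂̄^q f = 0` on `U` in the sense of
distributions. -/
def IsPolyanalyticOn (q : ℕ) (f : ℂ → ℂ) (U : Set ℂ) : Prop :=
  ContinuousOn f U ∧
    ∀ g : ℂ → ℂ, ContDiff ℝ ∞ g → HasCompactSupport g → tsupport g ⊆ U →
      ∫ w, f w * (dbar^[q] g) w ∂area = 0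

/-- Membership in `A²_{q,mQ}`, the space of `q`-analytic functions on `ℂ` that are
square-integrable with respect to `e^{-mQ} dA`. -/
def MemA2 (q : ℕ) (m : ℝ) (Q : ℂ → ℝ) (u : ℂ → ℂ) : Prop :=
  IsPolyanalyticOn q u univ ∧
    Integrable (fun w => ‖u w‖ ^ 2 * Real.exp (-m * Q w)) area

/-- The norm of `L²(e^{-mQ})`. -/
def wnorm (m : ℝ) (Q : ℂ → ℝ) (u : ℂ → ℂ) : ℝ :=
  Real.sqrt (∫ w, ‖u w‖ ^ 2 * Real.exp (-m * Q w) ∂area)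

/-- `P` is a polarization of `Q` on `𝔻(z₀, r)`: it is holomorphic in `z` and `w̄` for
`z, w ∈ 𝔻(z₀, r)`, and `P(z, z) = Q(z)`. -/
structure IsPolarization (Q : ℂ → ℝ) (z₀ : ℂ) (r : ℝ) (P : ℂ → ℂ → ℂ) : Prop where
  analytic : AnalyticOnNhd ℂ (fun p : ℂ × ℂ => P p.1 (conj p.2))
    (Metric.ball z₀ r ×ˢ Metric.ball (conj z₀) r)
  diag : ∀ z ∈ Metric.ball z₀ r, P z z = (Q z : ℂ)

/-- The phase function `θ(z,w) = (Q(w) - P(z,w)) / (w - z)`, continued to the diagonal by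
`θ(z,z) = ∂Q(z)`. -/
def phase (Q : ℂ → ℝ) (P : ℂ → ℂ → ℂ) (z w : ℂ) : ℂ :=
  if w = z then dz (fun ζ => (Q ζ : ℂ)) z else ((Q w : ℂ) - P z w) / (w - z)

/-- The conditions that the radius `r` and the polarization `P` are chosen to satisfy. -/
structure IsAdmissible (Q : ℂ → ℝ) (z₀ : ℂ) (r : ℝ) (P : ℂ → ℂ → ℂ) : Prop where
  pos : 0 < r
  analytic : AnalyticOnNhd ℝ Q (Metric.ball z₀ r)
  lap_pos : ∃ ε : ℝ, 0 < ε ∧ ∀ z ∈ Metric.ball z₀ r, ε < lap Q z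
  polar : IsPolarization Q z₀ r P
  mixed_ne : ∀ z ∈ Metric.ball z₀ r, ∀ w ∈ Metric.ball z₀ r,
    dz (fun ζ => dbar (fun η => P ζ η) w) z ≠ 0
  dbar_phase_ne : ∀ z ∈ Metric.ball z₀ r, ∀ w ∈ Metric.ball z₀ r,
    dbar (fun η => phase Q P z η) w ≠ 0
  bound : ∀ z ∈ Metric.ball z₀ r, ∀ w ∈ Metric.ball z₀ r,
    2 * (P z w).re - Q w - Q z ≤ -(1 / 2) * lap Q z₀ * ‖w - z‖ ^ 2

/-- A smooth non-negative cut-off function on the line which is `1` on `(-2/3, 2/3)` and has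
its (closed) support in `(-1, 1)`. -/
structure IsCutoff (χ₀ : ℝ → ℝ) : Prop where
  smooth : ContDiff ℝ ∞ χ₀
  nonneg : ∀ t, 0 ≤ χ₀ t
  eq_one : ∀ t ∈ Ioo (-(2 / 3) : ℝ) (2 / 3), χ₀ t = 1
  support : tsupport χ₀ ⊆ Ioo (-1 : ℝ) 1

/-- The exponential factor `e^{m (z - w) θ(z, w)}`. -/
def expPhase (m : ℝ) (Q : ℂ → ℝ) (P : ℂ → ℂ → ℂ) (z w : ℂ) : ℂ :=
  Complex.exp ((m : ℂ) * (z - w) * phase Q P z w)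

/-- The kernel
`R_{q,m}(z,w) = m ∑_{k=0}^{q-1} q! (-1)^k / ((q-1-k)! (k+1)! k!) (z̄ - w̄)^k
  ∂̄_w^k (∂̄_w θ e^{m(z-w)θ}) e^{-m(z-w)θ}`. -/
def kernelR (q : ℕ) (m : ℝ) (Q : ℂ → ℝ) (P : ℂ → ℂ → ℂ) (z w : ℂ) : ℂ :=
  (m : ℂ) * ∑ k ∈ Finset.range q,
    ((q ! : ℂ) * (-1) ^ k / (((q - 1 - k)! : ℂ) * ((k + 1)! : ℂ) * (k ! : ℂ))) *
      (conj z - conj w) ^ k *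
      (dbar^[k] (fun η => dbar (fun ξ => phase Q P z ξ) η * expPhase m Q P z η)) w *
      Complex.exp (-((m : ℂ) * (z - w) * phase Q P z w))

end Polyanalytic

end

/-!
The function `w̄ⁿ / (n! w)` is a fundamental solution of `∂̄ⁿ⁺¹`, so an `(n + 1)`-analytic `u`
satisfies `u(z) g(z) = -1/n! ∫ u(w) (w - z)⁻¹ ∂̄ⁿ⁺¹((w̄ - z̄)ⁿ g(w)) dA(w)` for every test
function `g`. As `u` is only a distributional solution, this is proved by testing `∂̄ⁿ⁺¹ u = 0`
against regularizations of the singular factor, with `1 / w` replaced by `w̄ / (|w|² + e)`, and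
letting `e → 0`.

Take `g = χ e^{m(z-w)θ(z,·)}`. Where `χ` is constant the integrand is `u` times the kernel,
because `∂̄ⁿ⁺¹((w̄ - z̄)ⁿ e^{m(z-w)θ}) = n! (z - w) R e^{m(z-w)θ}`. The rest comes from the
commutator of `∂̄ⁿ⁺¹` and `χ`, which lives where `|w - z|` is bounded below; there
`|e^{m(z-w)θ}| ≤ e^{mQ(z)/2 + mQ(w)/2 - cm|w-z|²/2}` beats the powers of `m` produced by the
derivatives, and the Cauchy-Schwarz inequality turns this into the weighted `L²` bound.

A polarization is found by reading the power series of `Q` in `re w` and `im w` as a power series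
in two independent complex variables. The left side of (4) is then minus a second difference of
`Q(·,·)`, hence close to `-ΔQ(z₀)|w - z|²`.
-/

noncomputable section

namespace Polyanalytic

open Filter Topology

/-! ### Calculus of the operator `∂̄` -/

section Calculus

variable {f g : ℂ → ℂ} {z : ℂ}

lemma dbar_congr (h : f =ᶠ[𝓝 z] g) : dbar f z = dbar g z := by
  simp only [dbar, h.fderiv_eq]

lemma iterate_dbar_eventuallyEq (h : f =ᶠ[𝓝 z] g) (n : ℕ) : dbar^[n] f =ᶠ[𝓝 z] dbar^[n] g := by
  induction n with
  | zero => exact h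
  | succ n ih =>
    simp only [Function.iterate_succ_apply']
    exact ih.eventuallyEq_nhds.mono fun _ => dbar_congr

lemma iterate_dbar_congr (h : f =ᶠ[𝓝 z] g) (n : ℕ) : (dbar^[n] f) z = (dbar^[n] g) z :=
  (iterate_dbar_eventuallyEq h n).eq_of_nhds

lemma dbar_const (c z : ℂ) : dbar (fun _ => c) z = 0 := by
  simp [dbar]

lemma dbar_add (hf : DifferentiableAt ℝ f z) (hg : DifferentiableAt ℝ g z) :
    dbar (fun w => f w + g w) z = dbar f z + dbar g z := by
  simp only [dbar, fderiv_fun_add hf hg, add_apply]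
  ring

lemma dbar_mul (hf : DifferentiableAt ℝ f z) (hg : DifferentiableAt ℝ g z) :
    dbar (fun w => f w * g w) z = dbar f z * g z + f z * dbar g z := by
  simp only [dbar, fderiv_fun_mul hf hg, add_apply, smul_apply, smul_eq_mul]
  ring

lemma dbar_const_mul (c : ℂ) (f : ℂ → ℂ) (z : ℂ) :
    dbar (fun w => c * f w) z = c * dbar f z := by
  have h : fderiv ℝ (fun w => c * f w) z = c • fderiv ℝ f z :=
    congrFun (fderiv_const_smul_field (𝕜 := ℝ) (f := f) c) z
  simp only [dbar, h, smul_apply, smul_eq_mul]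
  ring

lemma iterate_dbar_const_mul (c : ℂ) (f : ℂ → ℂ) (n : ℕ) :
    (dbar^[n] fun w => c * f w) = fun w => c * (dbar^[n] f) w := by
  induction n with
  | zero => rfl
  | succ n ih =>
    rw [Function.iterate_succ_apply', ih, Function.iterate_succ_apply']
    exact funext (dbar_const_mul c _)

lemma dbar_sum {ι : Type*} (s : Finset ι) {f : ι → ℂ → ℂ}
    (hf : ∀ i ∈ s, DifferentiableAt ℝ (f i) z) :
    dbar (fun w => ∑ i ∈ s, f i w) z = ∑ i ∈ s, dbar (f i) z := by
  simp only [dbar, fderiv_fun_sum hf, sum_apply, ← Finset.sum_div,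
    Finset.sum_add_distrib, Finset.mul_sum]

lemma dbar_comp_of_hasDerivAt {h : ℂ → ℂ} {h' : ℂ} (hh : HasDerivAt h h' (f z))
    (hf : DifferentiableAt ℝ f z) : dbar (fun w => h (f w)) z = h' * dbar f z := by
  have hfd := ((hh.hasFDerivAt.restrictScalars ℝ).comp z hf.hasFDerivAt).fderiv
  simp only [Function.comp_def] at hfd
  simp only [dbar, hfd, ContinuousLinearMap.comp_apply, ContinuousLinearMap.coe_restrictScalars',
    ContinuousLinearMap.toSpanSingleton_apply, smul_eq_mul]
  ring

lemma dbar_eq_zero_of_differentiableAt (hf : DifferentiableAt ℂ f z) : dbar f z = 0 := by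
  have hid : dbar (fun w => w) z = 0 := by simp [dbar]
  rw [dbar_comp_of_hasDerivAt (f := fun w => w) hf.hasDerivAt differentiableAt_id, hid, mul_zero]

lemma hasFDerivAt_conj (z : ℂ) :
    HasFDerivAt (fun w : ℂ => conj w) (Complex.conjCLE : ℂ →L[ℝ] ℂ) z :=
  Complex.conjCLE.hasFDerivAt

lemma contDiff_conj {n : WithTop ℕ∞} : ContDiff ℝ n (fun w : ℂ => conj w) :=
  Complex.conjCLE.contDiff

lemma dbar_conj_sub_const (c z : ℂ) : dbar (fun w => conj w - c) z = 1 := by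
  simp only [dbar, ((hasFDerivAt_conj z).sub_const c).fderiv]
  simp

lemma dbar_conj_sub_pow (c : ℂ) (n : ℕ) (z : ℂ) :
    dbar (fun w => (conj w - c) ^ n) z = n * (conj z - c) ^ (n - 1) := by
  rw [dbar_comp_of_hasDerivAt (hasDerivAt_pow n _)
    ((hasFDerivAt_conj z).sub_const c).differentiableAt, dbar_conj_sub_const, mul_one]

lemma iterate_dbar_conj_sub_pow (c : ℂ) (n i : ℕ) (z : ℂ) :
    (dbar^[i] fun w => (conj w - c) ^ n) z = n.descFactorial i * (conj z - c) ^ (n - i) := by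
  induction i generalizing z with
  | zero => simp
  | succ i ih =>
    rw [Function.iterate_succ_apply', funext ih, dbar_const_mul, dbar_conj_sub_pow,
      Nat.descFactorial_succ, Nat.sub_sub]
    push_cast
    ring

lemma contDiffAt_dbar {m n : WithTop ℕ∞} (hf : ContDiffAt ℝ n f z) (hmn : m + 1 ≤ n) :
    ContDiffAt ℝ m (dbar f) z := by
  have h : ContDiffAt ℝ m (fderiv ℝ f) z := hf.fderiv_right hmn
  exact ((h.clm_apply contDiffAt_const).add
    (contDiffAt_const.mul (h.clm_apply contDiffAt_const))).div_const 2

lemma contDiffAt_iterate_dbar {m : WithTop ℕ∞} {n : ℕ} (hf : ContDiffAt ℝ (m + n) f z) :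
    ContDiffAt ℝ m (dbar^[n] f) z := by
  induction n generalizing m with
  | zero => simpa using hf
  | succ n ih =>
    rw [Function.iterate_succ_apply']
    refine contDiffAt_dbar (ih (m := m + 1) ?_) le_rfl
    convert hf using 1
    push_cast
    ring

lemma contDiff_iterate_dbar (hf : ContDiff ℝ ∞ f) (n : ℕ) : ContDiff ℝ ∞ (dbar^[n] f) :=
  contDiff_iff_contDiffAt.2 fun _ => contDiffAt_iterate_dbar hf.contDiffAt

lemma differentiableAt_iterate_dbar {n i : ℕ} (hf : ContDiffAt ℝ n f z) (hi : i < n) :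
    DifferentiableAt ℝ (dbar^[i] f) z := by
  have h : ContDiffAt ℝ (1 + i) f z := hf.of_le (by exact_mod_cast (by omega : 1 + i ≤ n))
  exact (contDiffAt_iterate_dbar h).differentiableAt one_ne_zero

lemma iterate_dbar_add {n : ℕ} (hf : ContDiffAt ℝ n f z) (hg : ContDiffAt ℝ n g z) :
    (dbar^[n] fun w => f w + g w) z = (dbar^[n] f) z + (dbar^[n] g) z := by
  induction n generalizing z with
  | zero => rfl
  | succ n ih =>
    have hle : ((n : ℕ) : WithTop ℕ∞) ≤ (n + 1 : ℕ) := by exact_mod_cast n.le_succ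
    have ih' := ((hf.of_le hle).eventually (by simp)).and ((hg.of_le hle).eventually (by simp))
      |>.mono fun w hw => ih hw.1 hw.2
    simp only [Function.iterate_succ_apply']
    rw [dbar_congr ih', dbar_add (differentiableAt_iterate_dbar hf n.lt_succ_self)
      (differentiableAt_iterate_dbar hg n.lt_succ_self)]

lemma iterate_dbar_sum {ι : Type*} (s : Finset ι) {f : ι → ℂ → ℂ} {n : ℕ}
    (hf : ∀ i ∈ s, ContDiffAt ℝ n (f i) z) :
    (dbar^[n] fun w => ∑ i ∈ s, f i w) z = ∑ i ∈ s, (dbar^[n] (f i)) z := by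
  classical
  induction s using Finset.induction_on with
  | empty => simpa using congrFun (iterate_dbar_const_mul 0 0 n) z
  | insert i s hi ih =>
    simp only [Finset.sum_insert hi]
    rw [iterate_dbar_add (hf i (s.mem_insert_self i)) (ContDiffAt.sum fun j hj =>
      hf j (Finset.mem_insert_of_mem hj)), ih fun j hj => hf j (Finset.mem_insert_of_mem hj)]

lemma iterate_dbar_mul {n : ℕ} (hf : ContDiffAt ℝ n f z) (hg : ContDiffAt ℝ n g z) :
    (dbar^[n] fun w => f w * g w) z =
      ∑ i ∈ Finset.range (n + 1), n.choose i * ((dbar^[i] f) z * (dbar^[n - i] g) z) := by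
  induction n generalizing z with
  | zero => simp
  | succ n ih =>
    have hle : ((n : ℕ) : WithTop ℕ∞) ≤ (n + 1 : ℕ) := by exact_mod_cast n.le_succ
    have df {i : ℕ} (hi : i < n + 1) := differentiableAt_iterate_dbar hf hi
    have dg {i : ℕ} (hi : i < n + 1) := differentiableAt_iterate_dbar hg hi
    have ih' := ((hf.of_le hle).eventually (by simp)).and ((hg.of_le hle).eventually (by simp))
      |>.mono fun w hw => ih hw.1 hw.2
    have dfg (i : ℕ) (hi : i ∈ Finset.range (n + 1)) := (df (Finset.mem_range.1 hi)).fun_mul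
      (dg (i := n - i) (by omega))
    rw [Function.iterate_succ_apply', dbar_congr ih', dbar_sum _ fun i hi => (dfg i hi).const_mul _,
      Finset.sum_choose_succ_mul (fun i j => (dbar^[i] f) z * (dbar^[j] g) z) n,
      ← Finset.sum_add_distrib]
    refine Finset.sum_congr rfl fun i hi => ?_
    have hi' : n + 1 - i = n - i + 1 := by have := Finset.mem_range.1 hi; omega
    rw [dbar_const_mul, dbar_mul (df (Finset.mem_range.1 hi)) (dg (by omega)), hi',
      Function.iterate_succ_apply', Function.iterate_succ_apply']
    ring

lemma iterate_dbar_holomorphic_mul {h : ℂ → ℂ} {n : ℕ} (hh : AnalyticAt ℂ h z)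
    (hf : ContDiffAt ℝ n f z) :
    (dbar^[n] fun w => h w * f w) z = h z * (dbar^[n] f) z := by
  induction n generalizing z with
  | zero => rfl
  | succ n ih =>
    have ih' := hh.eventually_analyticAt.and
      ((hf.of_le (m := n) (by exact_mod_cast n.le_succ)).eventually (by simp))
      |>.mono fun w hw => ih hw.1 hw.2
    rw [Function.iterate_succ_apply', dbar_congr ih', dbar_mul
      (hh.differentiableAt.restrictScalars ℝ) (differentiableAt_iterate_dbar hf n.lt_succ_self),
      dbar_eq_zero_of_differentiableAt hh.differentiableAt, zero_mul, zero_add,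
      Function.iterate_succ_apply']

lemma tsupport_dbar_subset (f : ℂ → ℂ) : tsupport (dbar f) ⊆ tsupport f := by
  refine closure_minimal (fun z hz => ?_) (isClosed_tsupport f)
  by_contra h
  exact hz ((dbar_congr (notMem_tsupport_iff_eventuallyEq.1 h)).trans (dbar_const 0 z))

lemma tsupport_iterate_dbar_subset (f : ℂ → ℂ) (n : ℕ) : tsupport (dbar^[n] f) ⊆ tsupport f := by
  induction n with
  | zero => exact subset_rfl
  | succ n ih =>
    rw [Function.iterate_succ_apply']
    exact (tsupport_dbar_subset _).trans ih

lemma norm_iterate_dbar_mul_le {n : ℕ} {M N : ℝ} (hM : 0 ≤ M) (hf : ContDiffAt ℝ n f z)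
    (hg : ContDiffAt ℝ n g z) (hfM : ∀ i ≤ n, ‖(dbar^[i] f) z‖ ≤ M)
    (hgN : ∀ i ≤ n, ‖(dbar^[i] g) z‖ ≤ N) :
    ‖(dbar^[n] fun w => f w * g w) z‖ ≤ 2 ^ n * (M * N) := by
  rw [iterate_dbar_mul hf hg]
  calc _ ≤ ∑ i ∈ Finset.range (n + 1), (n.choose i : ℝ) * (M * N) := by
        refine norm_sum_le_of_le _ fun i hi => ?_
        rw [norm_mul, norm_mul, Complex.norm_natCast]
        gcongr
        · exact hfM i (Finset.mem_range_succ_iff.1 hi)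
        · exact hgN _ (n.sub_le i)
    _ = 2 ^ n * (M * N) := by
        rw [← Finset.sum_mul]
        exact_mod_cast congrArg (fun k : ℕ => (k : ℝ) * (M * N)) (Nat.sum_range_choose n)

end Calculus

/-- The commutator `[∂̄ⁿ, g]` of `∂̄ⁿ` with the multiplication by `g`, applied to `f`. -/
def dbarComm (n : ℕ) (g f : ℂ → ℂ) (w : ℂ) : ℂ :=
  (dbar^[n] fun η => g η * f η) w - g w * (dbar^[n] f) w

section Commutator

variable {f g : ℂ → ℂ} {n : ℕ} {w : ℂ}

lemma dbarComm_eq_sum (hg : ContDiffAt ℝ n g w) (hf : ContDiffAt ℝ n f w) :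
    dbarComm n g f w =
      ∑ i ∈ Finset.range n, n.choose i * ((dbar^[i] f) w * (dbar^[n - i] g) w) := by
  have h := iterate_dbar_mul hf hg
  rw [Finset.sum_range_succ, Nat.choose_self, Nat.sub_self] at h
  simp only [mul_comm (f _) (g _)] at h
  rw [dbarComm, h, Function.iterate_zero_apply]
  push_cast
  ring

lemma dbarComm_eq_zero_of_eventuallyEq_const {c : ℂ} (h : g =ᶠ[𝓝 w] fun _ => c) (n : ℕ)
    (f : ℂ → ℂ) : dbarComm n g f w = 0 := by
  have hmul : (fun η => g η * f η) =ᶠ[𝓝 w] fun η => c * f η :=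
    h.mono fun η hη => by simp only [hη]
  rw [dbarComm, iterate_dbar_congr hmul, iterate_dbar_const_mul, h.eq_of_nhds, sub_self]

lemma dbarComm_eq_zero_of_notMem_tsupport (hw : w ∉ tsupport g) (n : ℕ) (f : ℂ → ℂ) :
    dbarComm n g f w = 0 :=
  dbarComm_eq_zero_of_eventuallyEq_const (notMem_tsupport_iff_eventuallyEq.1 hw) n f

end Commutator

/-! ### A smooth regularization of the fundamental solution of `∂̄^q` -/

/-- The function `(w̄ - z̄)^q / (|w - z|² + e)` of `w`, which for `e > 0` is smooth and for `e → 0`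
regularizes `(w̄ - z̄)^(q - 1) / (w - z)`, a multiple of the fundamental solution of `∂̄^q`. -/
def regKernel (q : ℕ) (e : ℝ) (z w : ℂ) : ℂ :=
  (conj w - conj z) ^ q * ((w - z) * (conj w - conj z) + e)⁻¹

lemma sub_mul_conj_sub_add (e : ℝ) (z w : ℂ) :
    (w - z) * (conj w - conj z) + e = ((‖w - z‖ ^ 2 + e : ℝ) : ℂ) := by
  rw [← map_sub, Complex.mul_conj, Complex.normSq_eq_norm_sq]
  push_cast
  rfl

lemma sub_mul_conj_sub_add_ne_zero {e : ℝ} (he : 0 < e) (z w : ℂ) :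
    (w - z) * (conj w - conj z) + e ≠ 0 := by
  rw [sub_mul_conj_sub_add]
  exact_mod_cast (by positivity : ‖w - z‖ ^ 2 + e ≠ 0)

lemma contDiff_conj_sub_const {n : WithTop ℕ∞} (c : ℂ) : ContDiff ℝ n fun w : ℂ => conj w - c :=
  contDiff_conj.sub contDiff_const

lemma contDiff_regKernel (q : ℕ) {e : ℝ} (he : 0 < e) (z : ℂ) : ContDiff ℝ ∞ (regKernel q e z) :=
  ((contDiff_conj_sub_const _).pow q).mul
    ((((contDiff_id.sub contDiff_const).mul (contDiff_conj_sub_const _)).add contDiff_const).inv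
      (sub_mul_conj_sub_add_ne_zero he z))

lemma regKernel_succ (q : ℕ) (e : ℝ) (z : ℂ) :
    regKernel (q + 1) e z = fun w => (conj w - conj z) * regKernel q e z w := by
  ext w
  simp only [regKernel]
  ring

lemma regKernel_succ_of_ne (q : ℕ) {e : ℝ} (he : 0 < e) {z w : ℂ} (hw : w ≠ z) :
    regKernel (q + 1) e z w =
      (w - z)⁻¹ * ((conj w - conj z) ^ q + -(e : ℂ) * regKernel q e z w) := by
  have hsub := sub_ne_zero.2 hw
  have hden := sub_mul_conj_sub_add_ne_zero he z w
  simp only [regKernel]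
  generalize conj w - conj z = b at hden ⊢
  field_simp
  ring

lemma iterate_dbar_conj_sub_mul {f : ℂ → ℂ} {w : ℂ} {n : ℕ} (hf : ContDiffAt ℝ n f w) (c : ℂ) :
    (dbar^[n] fun w => (conj w - c) * f w) w =
      (conj w - c) * (dbar^[n] f) w + n * (dbar^[n - 1] f) w := by
  have hc : (fun w => conj w - c) = fun w => (conj w - c) ^ 1 := by simp
  rw [iterate_dbar_mul (contDiff_conj_sub_const c).contDiffAt hf, hc]
  simp only [iterate_dbar_conj_sub_pow]
  rcases n with _ | n
  · simp
  rw [Finset.sum_range_succ', Finset.sum_range_succ', Finset.sum_eq_zero]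
  · simp [add_comm]
  · intro i _
    simp

lemma dbar_const_mul_inv_pow (a : ℂ) {e : ℝ} (he : 0 < e) (n : ℕ) (z w : ℂ) :
    dbar (fun w => a * (((w - z) * (conj w - conj z) + e) ^ n)⁻¹) w =
      -(a * n * (w - z) / ((w - z) * (conj w - conj z) + e) ^ (n + 1)) := by
  have hden := sub_mul_conj_sub_add_ne_zero he z w
  have hconj : DifferentiableAt ℝ (fun w : ℂ => conj w - conj z) w :=
    ((hasFDerivAt_conj w).sub_const _).differentiableAt
  have hid : DifferentiableAt ℂ (fun w : ℂ => w - z) w := by fun_prop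
  have hsub : DifferentiableAt ℝ (fun w : ℂ => w - z) w := hid.restrictScalars ℝ
  have hmul := hsub.fun_mul hconj
  have hinv := ((hasDerivAt_pow n ((w - z) * (conj w - conj z) + (e : ℂ))).fun_inv
    (pow_ne_zero n hden)).const_mul a
  refine (dbar_comp_of_hasDerivAt (f := fun w => (w - z) * (conj w - conj z) + (e : ℂ)) hinv
    (hmul.add_const (e : ℂ))).trans ?_
  rw [dbar_add hmul (differentiableAt_const _), dbar_const,
    dbar_mul hsub hconj, dbar_eq_zero_of_differentiableAt hid, dbar_conj_sub_const]
  rcases n with _ | n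
  · simp
  · rw [Nat.add_sub_cancel]
    field_simp
    ring

lemma iterate_dbar_regKernel_self (q : ℕ) {e : ℝ} (he : 0 < e) (z w : ℂ) :
    (dbar^[q] (regKernel q e z)) w =
      q ! * (e : ℂ) ^ q / ((w - z) * (conj w - conj z) + e) ^ (q + 1) := by
  induction q generalizing w with
  | zero => simp [regKernel]
  | succ q ih =>
    have hsmooth : ContDiffAt ℝ (q + 1 : ℕ) (regKernel q e z) w :=
      ((contDiff_regKernel q he z).of_le (by exact_mod_cast le_top)).contDiffAt
    rw [regKernel_succ, iterate_dbar_conj_sub_mul hsmooth, Nat.add_sub_cancel, ih,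
      Function.iterate_succ_apply', funext ih]
    simp only [div_eq_mul_inv]
    rw [dbar_const_mul_inv_pow _ he, Nat.factorial_succ]
    have hden := sub_mul_conj_sub_add_ne_zero he z w
    generalize conj w - conj z = b at hden ⊢
    generalize hD : (w - z) * b + (e : ℂ) = D at hden ⊢
    rw [← eq_sub_iff_add_eq] at hD
    push_cast
    field_simp
    linear_combination (-(q ! * (e : ℂ) ^ q * D ^ (q + 1))) * hD

lemma norm_iterate_dbar_regKernel_self_le (q : ℕ) {e : ℝ} (he : 0 < e) (z w : ℂ) :
    ‖(dbar^[q] (regKernel q e z)) w‖ ≤ q ! / (‖w - z‖ ^ 2 + e) := by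
  have hratio : e / (‖w - z‖ ^ 2 + e) ≤ 1 := by
    rw [div_le_one (by positivity)]
    exact le_add_of_nonneg_left (sq_nonneg _)
  rw [iterate_dbar_regKernel_self q he, sub_mul_conj_sub_add, norm_div, norm_mul, norm_pow,
    norm_pow, Complex.norm_natCast, Complex.norm_real, Complex.norm_real,
    Real.norm_of_nonneg he.le, Real.norm_of_nonneg (by positivity)]
  calc (q ! : ℝ) * e ^ q / (‖w - z‖ ^ 2 + e) ^ (q + 1)
      = q ! / (‖w - z‖ ^ 2 + e) * (e / (‖w - z‖ ^ 2 + e)) ^ q := by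
        rw [div_pow, pow_succ]
        field_simp
    _ ≤ q ! / (‖w - z‖ ^ 2 + e) :=
        mul_le_of_le_one_right (by positivity) (pow_le_one₀ (by positivity) hratio)

lemma exists_norm_iterate_dbar_regKernel_le {q i : ℕ} (hi : i ≤ q) :
    ∃ C : ℝ, 0 ≤ C ∧ ∀ e : ℝ, 0 < e → ∀ z w : ℂ,
      ‖(dbar^[i] (regKernel q e z)) w‖ ≤ C * ‖w - z‖ ^ (q - i) / (‖w - z‖ ^ 2 + e) := by
  induction q generalizing i with
  | zero =>
    obtain rfl : i = 0 := by omega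
    exact ⟨1, zero_le_one, fun e he z w => by
      simpa using norm_iterate_dbar_regKernel_self_le 0 he z w⟩
  | succ q ih =>
    rcases hi.eq_or_lt with rfl | hi
    · exact ⟨(q + 1)!, by positivity, fun e he z w => by
        simpa using norm_iterate_dbar_regKernel_self_le (q + 1) he z w⟩
    obtain ⟨C₁, hC₁, h₁⟩ := ih (i := i) (by omega)
    obtain ⟨C₂, hC₂, h₂⟩ := ih (i := i - 1) (by omega)
    refine ⟨C₁ + i * C₂, by positivity, fun e he z w => ?_⟩
    have hsmooth : ContDiffAt ℝ i (regKernel q e z) w :=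
      ((contDiff_regKernel q he z).of_le (by exact_mod_cast le_top)).contDiffAt
    rw [regKernel_succ, iterate_dbar_conj_sub_mul hsmooth]
    refine (norm_add_le _ _).trans ?_
    rw [norm_mul, norm_mul, Complex.norm_natCast, ← map_sub, Complex.norm_conj, add_mul, add_div]
    refine add_le_add ?_ ?_
    · refine (mul_le_mul_of_nonneg_left (h₁ e he z w) (norm_nonneg _)).trans_eq ?_
      rw [show q + 1 - i = q - i + 1 by omega, pow_succ]
      ring
    · rcases i with _ | i
      · simp
      · refine (mul_le_mul_of_nonneg_left (h₂ e he z w) (by positivity)).trans_eq ?_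
        rw [show q + 1 - (i + 1) = q - (i + 1 - 1) by omega]
        ring

lemma exists_norm_iterate_dbar_regKernel_succ_le {q i : ℕ} (hi : i ≤ q) :
    ∃ C : ℝ, ∀ e : ℝ, 0 < e → ∀ z w : ℂ,
      ‖(dbar^[i] (regKernel (q + 1) e z)) w‖ ≤ C * ‖w - z‖ ^ (q - i) * ‖w - z‖⁻¹ := by
  obtain ⟨C, hC, h⟩ := exists_norm_iterate_dbar_regKernel_le (Nat.le_succ_of_le hi)
  refine ⟨C, fun e he z w => (h e he z w).trans ?_⟩
  rcases (norm_nonneg (w - z)).eq_or_lt with h0 | h0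
  · simp [← h0, Nat.sub_ne_zero_of_lt (Nat.lt_succ_of_le hi)]
  rw [Nat.succ_sub hi, pow_succ, div_le_iff₀ (by positivity)]
  calc C * (‖w - z‖ ^ (q - i) * ‖w - z‖)
      = C * ‖w - z‖ ^ (q - i) * ‖w - z‖⁻¹ * ‖w - z‖ ^ 2 := by field_simp
    _ ≤ _ := by gcongr; exact le_add_of_nonneg_right he.le

lemma tendsto_mul_iterate_dbar_regKernel {q i : ℕ} (hi : i ≤ q) {z w : ℂ} (hw : w ≠ z) :
    Tendsto (fun e : ℝ => (e : ℂ) * (dbar^[i] (regKernel q e z)) w) (𝓝[>] 0) (𝓝 0) := by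
  obtain ⟨C, hC, h⟩ := exists_norm_iterate_dbar_regKernel_le hi
  have hpos : 0 < ‖w - z‖ := norm_pos_iff.2 (sub_ne_zero.2 hw)
  have hlim : Tendsto (fun e : ℝ => e * (C * ‖w - z‖ ^ (q - i) / ‖w - z‖ ^ 2)) (𝓝[>] 0) (𝓝 0) :=
    (Continuous.tendsto' (by fun_prop) _ _ (by simp)).mono_left nhdsWithin_le_nhds
  refine squeeze_zero_norm' ?_ hlim
  filter_upwards [self_mem_nhdsWithin] with e he
  rw [mem_Ioi] at he
  rw [norm_mul, Complex.norm_real, Real.norm_of_nonneg he.le]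
  refine mul_le_mul_of_nonneg_left ((h e he z w).trans ?_) he.le
  gcongr
  exact le_add_of_nonneg_right he.le

lemma tendsto_iterate_dbar_regKernel_succ {q i : ℕ} (hi : i ≤ q) {z w : ℂ} (hw : w ≠ z) :
    Tendsto (fun e : ℝ => (dbar^[i] (regKernel (q + 1) e z)) w) (𝓝[>] 0)
      (𝓝 ((w - z)⁻¹ * (dbar^[i] fun η => (conj η - conj z) ^ q) w)) := by
  have hlim := ((tendsto_mul_iterate_dbar_regKernel hi hw).const_sub
    ((dbar^[i] fun η => (conj η - conj z) ^ q) w)).const_mul (w - z)⁻¹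
  rw [sub_zero] at hlim
  refine hlim.congr' ?_
  filter_upwards [self_mem_nhdsWithin] with e he
  have hpow : ContDiff ℝ i fun η : ℂ => (conj η - conj z) ^ q := (contDiff_conj_sub_const _).pow q
  have hreg : ContDiff ℝ i (regKernel q e z) :=
    (contDiff_regKernel q he z).of_le (by exact_mod_cast le_top)
  have heq : regKernel (q + 1) e z =ᶠ[𝓝 w] fun η =>
      (η - z)⁻¹ * ((conj η - conj z) ^ q + -(e : ℂ) * regKernel q e z η) :=
    (eventually_ne_nhds hw).mono fun η => regKernel_succ_of_ne q he
  have hinv : AnalyticAt ℂ (fun η : ℂ => (η - z)⁻¹) w :=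
    (analyticAt_id.sub analyticAt_const).inv (sub_ne_zero.2 hw)
  rw [iterate_dbar_congr heq, iterate_dbar_holomorphic_mul hinv
    (hpow.contDiffAt.add (contDiffAt_const.mul hreg.contDiffAt)), iterate_dbar_add hpow.contDiffAt
    (contDiffAt_const.mul hreg.contDiffAt), iterate_dbar_const_mul]
  ring

/-! ### Integration against the area measure -/

lemma integral_area {F : Type*} [NormedAddCommGroup F] [NormedSpace ℝ F] (f : ℂ → F) :
    ∫ w, f w ∂area = Real.pi⁻¹ • ∫ w, f w := by
  rw [area, integral_smul_measure, ENNReal.toReal_ofReal (by positivity)]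

lemma integrable_area_iff {F : Type*} [NormedAddCommGroup F] {f : ℂ → F} :
    Integrable f area ↔ Integrable f :=
  integrable_smul_measure (by simpa using Real.pi_pos) ENNReal.ofReal_ne_top

instance : IsFiniteMeasureOnCompacts area :=
  ⟨fun K hK => by
    simpa [area] using ENNReal.mul_lt_top ENNReal.ofReal_lt_top hK.measure_lt_top⟩

instance : NullSingletonClass area :=
  ⟨fun z => by simp [area]⟩

lemma integrableOn_inv_norm_ball (R : ℝ) :
    IntegrableOn (fun w : ℂ => ‖w‖⁻¹) (Metric.ball 0 R) := by
  rw [integrableOn_fun_norm_addHaar volume (f := fun y => y⁻¹), Complex.finrank_real_complex]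
  refine IntegrableOn.congr_fun (f := fun _ => (1 : ℝ)) (by simp) (fun y hy => ?_)
    measurableSet_Ioo
  simp [hy.1.ne']

lemma integrable_mul_inv_norm_sub {F : ℂ → ℝ} (hF : Continuous F) (hFc : HasCompactSupport F)
    (z : ℂ) : Integrable (fun w => F w * ‖w - z‖⁻¹) area := by
  have hloc : LocallyIntegrable fun w : ℂ => ‖w‖⁻¹ := fun w =>
    ⟨Metric.ball 0 (‖w‖ + 1), Metric.isOpen_ball.mem_nhds (by simp), integrableOn_inv_norm_ball _⟩
  have hshift := hloc.integrable_smul_left_of_hasCompactSupport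
    (hF.comp (continuous_add_const z)) (hFc.comp_homeomorph (Homeomorph.addRight z))
  rw [integrable_area_iff]
  simpa using hshift.comp_sub_right z

/-! ### An approximate identity -/

/-- The rotation invariant probability density `(q + 1) / (π (1 + |v|²)^(q + 2))` on the plane; its
rescalings are multiples of `∂̄^(q + 1)` of the regularized kernels. -/
def bump (q : ℕ) (v : ℂ) : ℝ := Real.pi⁻¹ * ((q + 1) / (‖v‖ ^ 2 + 1) ^ (q + 2))

lemma bump_nonneg (q : ℕ) (v : ℂ) : 0 ≤ bump q v := by
  unfold bump
  positivity

lemma hasDerivAt_inv_sq_add_one_pow (q : ℕ) (y : ℝ) :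
    HasDerivAt (fun y : ℝ => -(2 * Real.pi)⁻¹ * ((y ^ 2 + 1) ^ (q + 1))⁻¹)
      (y * (Real.pi⁻¹ * ((q + 1) / (y ^ 2 + 1) ^ (q + 2)))) y := by
  have hpow : HasDerivAt (fun y : ℝ => (y ^ 2 + 1) ^ (q + 1))
      ((q + 1 : ℕ) * (y ^ 2 + 1) ^ q * (2 * y)) y := by
    simpa using ((hasDerivAt_pow 2 y).add_const 1).fun_pow (q + 1)
  refine ((hpow.fun_inv (by positivity)).const_mul _).congr_deriv ?_
  have := Real.pi_ne_zero
  push_cast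
  field_simp
  ring

lemma tendsto_inv_sq_add_one_pow (q : ℕ) :
    Tendsto (fun y : ℝ => ((y ^ 2 + 1) ^ (q + 1))⁻¹) atTop (𝓝 0) :=
  tendsto_inv_atTop_zero.comp <| (tendsto_pow_atTop q.succ_ne_zero).comp
    (tendsto_atTop_add_const_right _ _ (tendsto_pow_atTop two_ne_zero))

lemma integral_bump (q : ℕ) : ∫ v, bump q v = 1 := by
  have hball : volume.real (Metric.ball (0 : ℂ) 1) = Real.pi := by
    simp [Measure.real, Complex.volume_ball]
  have hradial := integral_fun_norm_addHaar (volume : Measure ℂ)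
    (fun y : ℝ => Real.pi⁻¹ * (((q : ℝ) + 1) / (y ^ 2 + 1) ^ (q + 2)))
  simp only [hball, Complex.finrank_real_complex, Nat.add_one_sub_one, pow_one, smul_eq_mul]
    at hradial
  refine hradial.trans ?_
  rw [integral_Ioi_of_hasDerivAt_of_nonneg' (fun y _ => hasDerivAt_inv_sq_add_one_pow q y)
    (fun y hy => by rw [mem_Ioi] at hy; positivity)
    (by simpa using (tendsto_inv_sq_add_one_pow q).const_mul (-(2 * Real.pi)⁻¹))]
  have := Real.pi_ne_zero
  simp [field]

lemma tendsto_norm_sq_mul_bump (q : ℕ) :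
    Tendsto (fun v => ‖v‖ ^ 2 * bump q v) (Bornology.cobounded ℂ) (𝓝 0) := by
  have hlim := ((tendsto_inv_sq_add_one_pow q).comp
    (tendsto_norm_cobounded_atTop (E := ℂ))).const_mul (Real.pi⁻¹ * (q + 1))
  rw [mul_zero] at hlim
  refine squeeze_zero (fun v => mul_nonneg (sq_nonneg _) (bump_nonneg q v)) (fun v => ?_) hlim
  have hratio : ‖v‖ ^ 2 / (‖v‖ ^ 2 + 1) ≤ 1 := by
    rw [div_le_one (by positivity)]
    linarith
  calc ‖v‖ ^ 2 * bump q v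
      = Real.pi⁻¹ * (q + 1) * ((‖v‖ ^ 2 + 1) ^ (q + 1))⁻¹ * (‖v‖ ^ 2 / (‖v‖ ^ 2 + 1)) := by
        rw [bump]
        field_simp
        ring
    _ ≤ Real.pi⁻¹ * (q + 1) * ((‖v‖ ^ 2 + 1) ^ (q + 1))⁻¹ :=
        mul_le_of_le_one_right (by positivity) hratio

lemma iterate_dbar_regKernel_succ_self (q : ℕ) {c : ℝ} (hc : 0 < c) (z w : ℂ) :
    (dbar^[q + 1] (regKernel (q + 1) (c⁻¹ ^ 2) z)) w =
      q ! * Real.pi * (c ^ 2 * bump q (c • (z - w)) : ℝ) := by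
  have hscale : (c * ‖z - w‖) ^ 2 + 1 = c ^ 2 * (‖z - w‖ ^ 2 + c⁻¹ ^ 2) := by
    field_simp
  have hpos : 0 < ‖z - w‖ ^ 2 + c⁻¹ ^ 2 := by positivity
  rw [iterate_dbar_regKernel_self (q + 1) (by positivity), sub_mul_conj_sub_add, bump, norm_smul,
    norm_sub_rev w z, Real.norm_of_nonneg hc.le, hscale, Nat.factorial_succ]
  generalize ‖z - w‖ ^ 2 + c⁻¹ ^ 2 = D at hpos
  have := Real.pi_ne_zero
  norm_cast
  push_cast
  field_simp
  rw [div_pow, one_pow, mul_pow]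
  field_simp
  ring

lemma tendsto_inv_sq_nhdsGT_zero : Tendsto (fun c : ℝ => c⁻¹ ^ 2) atTop (𝓝[>] 0) := by
  refine tendsto_nhdsWithin_iff.2 ⟨by simpa using (tendsto_inv_atTop_zero (𝕜 := ℝ)).pow 2, ?_⟩
  filter_upwards [eventually_gt_atTop 0] with c hc
  exact mem_Ioi.2 (by positivity)

lemma tendsto_integral_mul_iterate_dbar_regKernel_self (q : ℕ) {F : ℂ → ℂ} (hF : Continuous F)
    (hFc : HasCompactSupport F) (z : ℂ) :
    Tendsto (fun c : ℝ => ∫ w, F w * (dbar^[q + 1] (regKernel (q + 1) (c⁻¹ ^ 2) z)) w ∂area) atTop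
      (𝓝 (q ! * F z)) := by
  have h := tendsto_integral_comp_smul_smul_of_integrable' (μ := (volume : Measure ℂ))
    (bump_nonneg q) (integral_bump q)
    (by simpa only [Complex.finrank_real_complex] using tendsto_norm_sq_mul_bump q) (x₀ := z)
    (hF.integrable_of_hasCompactSupport hFc) hF.continuousAt
  refine (h.const_mul (q ! : ℂ)).congr' ?_
  filter_upwards [eventually_gt_atTop 0] with c hc
  rw [integral_area, ← integral_smul, ← integral_const_mul]
  refine integral_congr_ae (.of_forall fun w => ?_)
  have : (Real.pi : ℂ) ≠ 0 := by exact_mod_cast Real.pi_ne_zero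
  simp only [iterate_dbar_regKernel_succ_self q hc, Complex.finrank_real_complex,
    Complex.real_smul]
  push_cast
  field_simp

/-! ### The Cauchy formula for `q`-analytic functions -/

section CauchyFormula

variable {F : ℂ → ℂ} {q i : ℕ}

lemma integrable_mul_iterate_dbar_conj_sub_pow (hF : Continuous F) (hFc : HasCompactSupport F)
    (q i : ℕ) (z : ℂ) : Integrable
      (fun w => F w * ((w - z)⁻¹ * (dbar^[i] fun η => (conj η - conj z) ^ q) w)) area := by
  have hpow : Continuous (dbar^[i] fun η => (conj η - conj z) ^ q) :=
    (contDiff_iterate_dbar ((contDiff_conj_sub_const _).pow q) i).continuous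
  refine (integrable_mul_inv_norm_sub (hF.mul hpow).norm hFc.mul_right.norm z).mono'
    (hF.measurable.mul ((measurable_id.sub_const z).inv.mul
      hpow.measurable)).aestronglyMeasurable (.of_forall fun w => le_of_eq ?_)
  rw [norm_mul, norm_mul, norm_inv, Pi.mul_apply, norm_mul]
  ring

lemma tendsto_integral_mul_iterate_dbar_regKernel_succ (hF : Continuous F)
    (hFc : HasCompactSupport F) (hi : i ≤ q) (z : ℂ) :
    Tendsto (fun e : ℝ => ∫ w, F w * (dbar^[i] (regKernel (q + 1) e z)) w ∂area) (𝓝[>] 0)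
      (𝓝 (∫ w, F w * ((w - z)⁻¹ * (dbar^[i] fun η => (conj η - conj z) ^ q) w) ∂area)) := by
  obtain ⟨C, hbound⟩ := exists_norm_iterate_dbar_regKernel_succ_le hi
  have hmajorant : Integrable (fun w => ‖F w‖ * (C * ‖w - z‖ ^ (q - i)) * ‖w - z‖⁻¹) area :=
    integrable_mul_inv_norm_sub (hF.norm.mul (by fun_prop)) hFc.norm.mul_right z
  refine tendsto_integral_filter_of_dominated_convergence _ ?_ ?_ hmajorant ?_
  · filter_upwards [self_mem_nhdsWithin] with e he
    exact (hF.mul (contDiff_iterate_dbar (contDiff_regKernel (q + 1) he z) i).continuous)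
      |>.aestronglyMeasurable
  · filter_upwards [self_mem_nhdsWithin] with e he
    refine .of_forall fun w => ?_
    rw [norm_mul, mul_assoc]
    exact mul_le_mul_of_nonneg_left (hbound e he z w) (norm_nonneg _)
  · filter_upwards [Measure.ae_ne area z] with w hw
    exact (tendsto_iterate_dbar_regKernel_succ hi hw).const_mul _

lemma iterate_dbar_succ_conj_sub_pow_mul {g : ℂ → ℂ} {w : ℂ} (q : ℕ)
    (hg : ContDiffAt ℝ (q + 1 : ℕ) g w) (c : ℂ) :
    (dbar^[q + 1] fun η => (conj η - c) ^ q * g η) w =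
      ∑ i ∈ Finset.range (q + 1), ((q + 1).choose i : ℂ) *
        ((dbar^[i] fun η => (conj η - c) ^ q) w * (dbar^[q + 1 - i] g) w) := by
  rw [iterate_dbar_mul ((contDiff_conj_sub_const c).pow q).contDiffAt hg, Finset.sum_range_succ,
    iterate_dbar_conj_sub_pow, Nat.descFactorial_of_lt q.lt_succ_self]
  simp

variable {u g : ℂ → ℂ} {U : Set ℂ}

lemma continuous_mul_iterate_dbar (hu : ContinuousOn u U) (hU : IsOpen U) (hg : ContDiff ℝ ∞ g)
    (hgU : tsupport g ⊆ U) (n : ℕ) : Continuous fun w => u w * (dbar^[n] g) w :=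
  (hu.mul (contDiff_iterate_dbar hg n).continuous.continuousOn).continuous_of_tsupport_subset hU
    (tsupport_mul_subset_right.trans ((tsupport_iterate_dbar_subset g n).trans hgU))

lemma hasCompactSupport_mul_iterate_dbar (u : ℂ → ℂ) (hgc : HasCompactSupport g) (n : ℕ) :
    HasCompactSupport fun w => u w * (dbar^[n] g) w :=
  (hgc.mono' ((subset_tsupport _).trans (tsupport_iterate_dbar_subset g n))).mul_left

/-- This is `∂̄^(q + 1) u = 0` tested against `g (w̄ - z̄)^(q + 1) / (|w - z|² + e)`. -/
lemma IsPolyanalyticOn.sum_integral_regKernel_eq_zero (hu : IsPolyanalyticOn (q + 1) u U)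
    (hU : IsOpen U) (hg : ContDiff ℝ ∞ g) (hgc : HasCompactSupport g) (hgU : tsupport g ⊆ U)
    {e : ℝ} (he : 0 < e) (z : ℂ) :
    ∑ i ∈ Finset.range (q + 1), ((q + 1).choose i : ℂ) *
      ∫ w, u w * (dbar^[q + 1 - i] g) w * (dbar^[i] (regKernel (q + 1) e z)) w ∂area +
        ∫ w, u w * g w * (dbar^[q + 1] (regKernel (q + 1) e z)) w ∂area = 0 := by
  have hreg := contDiff_regKernel (q + 1) he z
  have hterm (i : ℕ) : Integrable (fun w => ((q + 1).choose i : ℂ) *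
      (u w * (dbar^[q + 1 - i] g) w * (dbar^[i] (regKernel (q + 1) e z)) w)) area :=
    (((continuous_mul_iterate_dbar hu.1 hU hg hgU _).mul
      (contDiff_iterate_dbar hreg i).continuous).integrable_of_hasCompactSupport
        (hasCompactSupport_mul_iterate_dbar u hgc _).mul_right).const_mul _
  have hleibniz (w : ℂ) : u w * (dbar^[q + 1] fun w => regKernel (q + 1) e z w * g w) w =
      ∑ i ∈ Finset.range (q + 2), ((q + 1).choose i : ℂ) *
        (u w * (dbar^[q + 1 - i] g) w * (dbar^[i] (regKernel (q + 1) e z)) w) := by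
    rw [iterate_dbar_mul (hreg.of_le (by exact_mod_cast le_top)).contDiffAt
      (hg.of_le (by exact_mod_cast le_top)).contDiffAt, Finset.mul_sum]
    refine Finset.sum_congr rfl fun i _ => ?_
    ring
  have htest := hu.2 (fun w => regKernel (q + 1) e z w * g w) (hreg.mul hg) hgc.mul_left
    (tsupport_mul_subset_right.trans hgU)
  simp only [hleibniz] at htest
  rw [integral_finsetSum _ fun i _ => hterm i, Finset.sum_range_succ _ (q + 1)] at htest
  simpa only [integral_const_mul, Nat.choose_self, Nat.cast_one, one_mul, Nat.sub_self,
    Function.iterate_zero, id_eq] using htest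

theorem IsPolyanalyticOn.integral_mul_iterate_dbar (hu : IsPolyanalyticOn (q + 1) u U)
    (hU : IsOpen U) (hg : ContDiff ℝ ∞ g) (hgc : HasCompactSupport g) (hgU : tsupport g ⊆ U)
    (z : ℂ) :
    Integrable (fun w => u w *
      ((w - z)⁻¹ * (dbar^[q + 1] fun η => (conj η - conj z) ^ q * g η) w)) area ∧
    ∫ w, u w * ((w - z)⁻¹ * (dbar^[q + 1] fun η => (conj η - conj z) ^ q * g η) w) ∂area =
      -(q ! * (u z * g z)) := by
  have hcont (n : ℕ) := continuous_mul_iterate_dbar hu.1 hU hg hgU n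
  have hsupp (n : ℕ) := hasCompactSupport_mul_iterate_dbar u hgc n
  have hexpand (w : ℂ) :
      u w * ((w - z)⁻¹ * (dbar^[q + 1] fun η => (conj η - conj z) ^ q * g η) w) =
        ∑ i ∈ Finset.range (q + 1), ((q + 1).choose i : ℂ) * (u w * (dbar^[q + 1 - i] g) w *
          ((w - z)⁻¹ * (dbar^[i] fun η => (conj η - conj z) ^ q) w)) := by
    rw [iterate_dbar_succ_conj_sub_pow_mul q (hg.of_le (by exact_mod_cast le_top)).contDiffAt,
      Finset.mul_sum, Finset.mul_sum]
    refine Finset.sum_congr rfl fun i _ => ?_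
    ring
  have hint (i : ℕ) : Integrable (fun w => ((q + 1).choose i : ℂ) * (u w *
      (dbar^[q + 1 - i] g) w * ((w - z)⁻¹ * (dbar^[i] fun η => (conj η - conj z) ^ q) w))) area :=
    (integrable_mul_iterate_dbar_conj_sub_pow (hcont _) (hsupp _) q i z).const_mul _
  simp only [hexpand]
  refine ⟨integrable_finsetSum _ fun i _ => hint i, ?_⟩
  have hlim := (tendsto_finsetSum (Finset.range (q + 1)) fun i hi =>
    ((tendsto_integral_mul_iterate_dbar_regKernel_succ (hcont (q + 1 - i)) (hsupp _)
      (Nat.lt_succ_iff.1 (Finset.mem_range.1 hi)) z).comp tendsto_inv_sq_nhdsGT_zero).const_mul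
        ((q + 1).choose i : ℂ)).add
    (tendsto_integral_mul_iterate_dbar_regKernel_self q (hcont 0) (hsupp 0) z)
  have hzero := tendsto_nhds_unique_of_eventuallyEq hlim (tendsto_const_nhds (x := (0 : ℂ)))
    ((eventually_gt_atTop 0).mono fun c hc =>
      hu.sum_integral_regKernel_eq_zero hU hg hgc hgU (pow_pos (inv_pos.2 hc) 2) z)
  rw [integral_finsetSum _ fun i _ => hint i]
  simp only [integral_const_mul]
  exact eq_neg_of_add_eq_zero_left hzero

end CauchyFormula

/-! ### Smooth `q`-analytic functions -/

section SmoothPolyanalytic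

variable {f g : ℂ → ℂ} {U : Set ℂ} {n : ℕ}

lemma integrable_mul_of_tsupport_subset (hU : IsOpen U) (hf : ContinuousOn f U)
    (hg : Continuous g) (hgc : HasCompactSupport g) (hgU : tsupport g ⊆ U) :
    Integrable fun w => f w * g w :=
  ((hf.mul hg.continuousOn).continuous_of_tsupport_subset hU
    (tsupport_mul_subset_right.trans hgU)).integrable_of_hasCompactSupport hgc.mul_left

lemma integral_mul_fderiv_apply (hU : IsOpen U) (hf : ContDiffOn ℝ 1 f U) (hg : ContDiff ℝ 1 g)
    (hgc : HasCompactSupport g) (hgU : tsupport g ⊆ U) (v : ℂ) :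
    Integrable (fun w => f w * fderiv ℝ g w v) ∧ Integrable (fun w => fderiv ℝ f w v * g w) ∧
      ∫ w, f w * fderiv ℝ g w v = -∫ w, fderiv ℝ f w v * g w := by
  have hfderiv : Integrable fun w => fderiv ℝ f w v * g w :=
    integrable_mul_of_tsupport_subset hU
      ((hf.continuousOn_fderiv_of_isOpen hU le_rfl).clm_apply continuousOn_const) hg.continuous
      hgc hgU
  have hgderiv : Integrable fun w => f w * fderiv ℝ g w v :=
    integrable_mul_of_tsupport_subset hU hf.continuousOn
      ((hg.continuous_fderiv one_ne_zero).clm_apply continuous_const) (hgc.fderiv_apply ℝ v)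
      ((tsupport_fderiv_apply_subset ℝ v).trans hgU)
  exact ⟨hgderiv, hfderiv, integral_mul_fderiv_eq_neg_fderiv_mul_of_integrable hfderiv hgderiv
    (integrable_mul_of_tsupport_subset hU hf.continuousOn hg.continuous hgc hgU)
    (fun x hx => (hf.contDiffAt (hU.mem_nhds (hgU hx))).differentiableAt one_ne_zero)
    (fun x _ => (hg.differentiable one_ne_zero).differentiableAt)⟩

lemma integral_mul_dbar (hU : IsOpen U) (hf : ContDiffOn ℝ 1 f U) (hg : ContDiff ℝ 1 g)
    (hgc : HasCompactSupport g) (hgU : tsupport g ⊆ U) :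
    ∫ w, f w * dbar g w ∂area = -∫ w, dbar f w * g w ∂area := by
  obtain ⟨hg₁, hf₁, h₁⟩ := integral_mul_fderiv_apply hU hf hg hgc hgU 1
  obtain ⟨hgI, hfI, hI⟩ := integral_mul_fderiv_apply hU hf hg hgc hgU Complex.I
  have hleft (w : ℂ) : f w * dbar g w = 2⁻¹ * (f w * fderiv ℝ g w 1 +
      Complex.I * (f w * fderiv ℝ g w Complex.I)) := by simp only [dbar]; ring
  have hright (w : ℂ) : dbar f w * g w = 2⁻¹ * (fderiv ℝ f w 1 * g w +
      Complex.I * (fderiv ℝ f w Complex.I * g w)) := by simp only [dbar]; ring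
  simp only [integral_area, hleft, hright]
  rw [integral_const_mul, integral_const_mul, integral_add hg₁ (hgI.const_mul _),
    integral_add hf₁ (hfI.const_mul _), integral_const_mul, integral_const_mul, h₁, hI, ← smul_neg]
  congr 1
  ring

lemma integral_mul_iterate_dbar (hU : IsOpen U) (hf : ContDiffOn ℝ n f U) (hg : ContDiff ℝ ∞ g)
    (hgc : HasCompactSupport g) (hgU : tsupport g ⊆ U) :
    ∫ w, f w * (dbar^[n] g) w ∂area = (-1) ^ n * ∫ w, (dbar^[n] f) w * g w ∂area := by
  induction n generalizing g with
  | zero => simp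
  | succ n ih =>
    have hsmooth : ContDiffOn ℝ 1 (dbar^[n] f) U := fun z hz =>
      (contDiffAt_iterate_dbar (n := n) ((hf.contDiffAt (hU.mem_nhds hz)).of_le
        (by rw [add_comm]; push_cast; exact le_rfl))).contDiffWithinAt
    rw [Function.iterate_succ_apply, ih (g := dbar g) (hf.of_le (by exact_mod_cast n.le_succ))
      (contDiff_iterate_dbar hg 1) (hgc.mono' ((subset_tsupport _).trans (tsupport_dbar_subset g)))
      ((tsupport_dbar_subset g).trans hgU),
      integral_mul_dbar hU hsmooth (hg.of_le (by exact_mod_cast le_top)) hgc hgU,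
      Function.iterate_succ_apply', pow_succ]
    ring

lemma isPolyanalyticOn_of_iterate_dbar_eq_zero (hU : IsOpen U) (hf : ContDiffOn ℝ n f U)
    (hzero : ∀ z ∈ U, (dbar^[n] f) z = 0) : IsPolyanalyticOn n f U := by
  refine ⟨hf.continuousOn, fun g hg hgc hgU => ?_⟩
  have hprod (w : ℂ) : (dbar^[n] f) w * g w = 0 := by
    by_cases hw : w ∈ tsupport g
    · rw [hzero w (hgU hw), zero_mul]
    · rw [image_eq_zero_of_notMem_tsupport hw, mul_zero]
  simp [integral_mul_iterate_dbar hU hf hg hgc hgU, hprod]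

lemma isPolyanalyticOn_sum_mul_conj_sub_pow (hU : IsOpen U) (q : ℕ) {h : ℕ → ℂ → ℂ}
    (hh : ∀ k, DifferentiableOn ℂ (h k) U) (c : ℂ) :
    IsPolyanalyticOn q (fun z => ∑ k ∈ Finset.range q, h k z * (conj z - c) ^ k) U := by
  have hpow (k : ℕ) {z : ℂ} : ContDiffAt ℝ q (fun z : ℂ => (conj z - c) ^ k) z :=
    ((contDiff_conj_sub_const c).pow k).contDiffAt
  have hhol (k : ℕ) {z : ℂ} (hz : z ∈ U) : AnalyticAt ℂ (h k) z :=
    (hh k).analyticAt (hU.mem_nhds hz)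
  have hterm (k : ℕ) {z : ℂ} (hz : z ∈ U) :
      ContDiffAt ℝ q (fun z => h k z * (conj z - c) ^ k) z :=
    ((hhol k hz).contDiffAt.restrict_scalars ℝ).mul (hpow k)
  refine isPolyanalyticOn_of_iterate_dbar_eq_zero hU
    (fun z hz => (ContDiffAt.sum fun k _ => hterm k hz).contDiffWithinAt) fun z hz => ?_
  rw [iterate_dbar_sum _ fun k _ => hterm k hz]
  refine Finset.sum_eq_zero fun k hk => ?_
  rw [iterate_dbar_holomorphic_mul (hhol k hz) (hpow k), iterate_dbar_conj_sub_pow,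
    Nat.descFactorial_of_lt (Finset.mem_range.1 hk)]
  simp

end SmoothPolyanalytic

/-! ### Averages of analytic functions -/

section Averages

variable {𝕜 E E' F α : Type*} [RCLike 𝕜] [NormedAddCommGroup E] [NormedSpace 𝕜 E]
  [NormedAddCommGroup E'] [NormedSpace 𝕜 E'] [NormedAddCommGroup F] [NormedSpace 𝕜 F]
  [NormedSpace ℝ F] [MeasurableSpace α] {μ : Measure α} [IsFiniteMeasure μ]

lemma hasFPowerSeriesOnBall_integral {f : α → E → F} {p : α → FormalMultilinearSeries 𝕜 E F}
    {x : E} {a : ℕ → ℝ} {ρ : NNReal} (hρ : 0 < ρ)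
    (hf : ∀ᵐ t ∂μ, HasFPowerSeriesOnBall (f t) (p t) x ρ)
    (hmeas : ∀ n, AEStronglyMeasurable (fun t => p t n) μ)
    (hbound : ∀ᵐ t ∂μ, ∀ n, ‖p t n‖ ≤ a n) (hsum : Summable fun n => a n * ρ ^ n) :
    HasFPowerSeriesOnBall (fun v => ∫ t, f t v ∂μ) (fun n => ∫ t, p t n ∂μ) x ρ := by
  have hint (n : ℕ) : Integrable (fun t => p t n) μ :=
    .of_bound (hmeas n) (a n) (hbound.mono fun t ht => ht n)
  refine ⟨FormalMultilinearSeries.le_radius_of_summable_norm _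
    ((hsum.mul_left (μ.real univ)).of_nonneg_of_le (fun n => by positivity) fun n => ?_),
    by exact_mod_cast hρ, fun {v} hv => ?_⟩
  · rw [← mul_assoc, mul_comm (μ.real univ)]
    gcongr
    exact norm_integral_le_of_norm_le_const (hbound.mono fun t ht => ht n)
  · have hv' : ‖v‖ ≤ ρ := by exact_mod_cast (mem_eball_zero_iff.1 hv).le
    simp only [ContinuousMultilinearMap.integral_apply (hint _)]
    refine hasSum_integral_of_dominated_convergence (fun n _ => a n * ρ ^ n)
      (fun n => (ContinuousMultilinearMap.apply 𝕜 _ F fun _ => v).continuous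
        |>.comp_aestronglyMeasurable (hmeas n))
      (fun n => hbound.mono fun t ht => ?_) (.of_forall fun _ => hsum) (integrable_const _)
      (hf.mono fun t ht => ht.hasSum hv)
    refine ((p t n).le_opNorm _).trans ?_
    rw [Finset.prod_const, Finset.card_fin]
    have := (norm_nonneg (p t n)).trans (ht n)
    gcongr
    exact ht n

lemma analyticAt_integral_comp_clm {f : E → F} {M : α → E' →L[𝕜] E} {x : E'} {y : E} {K : ℝ}
    (hM : AEStronglyMeasurable M μ) (hMK : ∀ᵐ t ∂μ, ‖M t‖ ≤ K) (hMx : ∀ t, M t x = y)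
    (hf : AnalyticAt 𝕜 f y) : AnalyticAt 𝕜 (fun v => ∫ t, f (M t v) ∂μ) x := by
  obtain ⟨p, R, hp⟩ := hf
  obtain ⟨s, hs0, hsR⟩ := ENNReal.lt_iff_exists_nnreal_btwn.1 hp.r_pos
  have hs : 0 < s := by exact_mod_cast hs0
  set L : NNReal := K.toNNReal + 1
  have hL : 0 < L := by positivity
  have hML : ∀ᵐ t ∂μ, ‖M t‖₊ ≤ L := hMK.mono fun t ht => by
    exact (NNReal.le_toNNReal_of_coe_le ht).trans (le_add_of_nonneg_right zero_le_one)
  refine ⟨_, _, hasFPowerSeriesOnBall_integral (p := fun t => p.compContinuousLinearMap (M t))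
    (a := fun n => ‖p n‖ * L ^ n) (ρ := s / L) (div_pos hs hL) (hML.mono fun t ht => ?_)
    (fun n => ?_) (hML.mono fun t ht n => ?_) ?_⟩
  · refine (hMx t ▸ hp).compContinuousLinearMap.mono (by exact_mod_cast div_pos hs hL) ?_
    rw [ENNReal.coe_div hL.ne']
    gcongr
    exact_mod_cast ht
  · exact ((ContinuousMultilinearMap.compContinuousLinearMapContinuousMultilinear 𝕜
      (fun _ : Fin n => E') (fun _ : Fin n => E) F).cont.comp
      (continuous_pi fun _ => continuous_id)).clm_apply continuous_const
      |>.comp_aestronglyMeasurable hM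
  · refine ((p n).norm_compContinuousLinearMap_le _).trans ?_
    rw [Finset.prod_const, Finset.card_fin]
    gcongr
    exact ht
  · refine (p.summable_norm_mul_pow (hsR.trans_le hp.r_le)).congr fun n => ?_
    have : (L : ℝ) ≠ 0 := by exact_mod_cast hL.ne'
    rw [NNReal.coe_div, div_pow, mul_assoc, mul_div_cancel₀ _ (pow_ne_zero n this)]

end Averages

section DividedDifferences

variable {E F : Type*} [NormedAddCommGroup E] [NormedSpace ℂ E] [NormedAddCommGroup F]
  [NormedSpace ℂ F]

lemma deriv_comp_prodMk_left {p : ℂ × E → F} {z : ℂ} {b : E} (h : DifferentiableAt ℂ p (z, b)) :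
    deriv (fun ζ => p (ζ, b)) z = fderiv ℂ p (z, b) (1, 0) :=
  (h.hasFDerivAt.comp_hasDerivAt z ((hasDerivAt_id z).prodMk (hasDerivAt_const z b))).deriv

variable [CompleteSpace F]

lemma dslope_eq_integral {f : ℂ → F} {s : Set ℂ} (hs : Convex ℝ s) (hf : AnalyticOnNhd ℂ f s)
    {a c : ℂ} (ha : a ∈ s) (hc : c ∈ s) :
    dslope f a c = ∫ t in (0 : ℝ)..1, deriv f (a + t • (c - a)) := by
  have hmem : ∀ t ∈ Icc (0 : ℝ) 1, a + t • (c - a) ∈ s := fun t ht =>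
    hs.add_smul_sub_mem ha hc ht
  have hcont : ContinuousOn (fun t : ℝ => deriv f (a + t • (c - a))) (Icc 0 1) :=
    hf.deriv.continuousOn.comp (by fun_prop) hmem
  obtain rfl | hca := eq_or_ne c a
  · simp
  · have := intervalIntegral.integral_unitInterval_deriv_eq_sub hcont fun t ht =>
      (hf _ (hmem t ht)).differentiableAt.hasDerivAt
    rw [dslope_of_ne _ hca, slope, vsub_eq_sub, inv_smul_eq_iff₀ (sub_ne_zero.2 hca), this,
      add_sub_cancel]

lemma analyticAt_dslope_fst_self {p : ℂ × E → F} {a : ℂ} {b : E} (hp : AnalyticAt ℂ p (a, b)) :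
    AnalyticAt ℂ (fun x : ℂ × ℂ × E => dslope (fun ζ => p (ζ, x.2.2)) x.1 x.2.1) (a, a, b) := by
  let M (t : ℝ) : ℂ × ℂ × E →L[ℂ] ℂ × E :=
    (ContinuousLinearMap.fst ℂ ℂ (ℂ × E)).prod
      ((ContinuousLinearMap.snd ℂ ℂ E).comp (ContinuousLinearMap.snd ℂ ℂ (ℂ × E))) +
    (t : ℂ) • ((ContinuousLinearMap.fst ℂ ℂ E).comp (ContinuousLinearMap.snd ℂ ℂ (ℂ × E)) -
      ContinuousLinearMap.fst ℂ ℂ (ℂ × E)).prod 0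
  have hM (t : ℝ) (x : ℂ × ℂ × E) : M t x = (x.1 + t • (x.2.1 - x.1), x.2.2) := by simp [M]
  have hMcont : Continuous M := by fun_prop
  obtain ⟨K, hK⟩ := (isCompact_Icc (a := (0 : ℝ)) (b := 1)).exists_bound_of_continuousOn
    hMcont.continuousOn
  have hderiv : AnalyticAt ℂ (fun y => fderiv ℂ p y (1, 0)) (a, b) :=
    ((ContinuousLinearMap.apply ℂ F ((1, 0) : ℂ × E)).analyticAt _).comp hp.fderiv
  refine (analyticAt_integral_comp_clm (μ := volume.restrict (Ioc (0 : ℝ) 1)) (x := (a, a, b))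
    hMcont.aestronglyMeasurable ((ae_restrict_mem measurableSet_Ioc).mono fun t ht =>
      hK t (Ioc_subset_Icc_self ht)) (fun t => by simp [hM]) hderiv).congr ?_
  obtain ⟨ε, hε, hball⟩ := Metric.eventually_nhds_iff_ball.1 hp.eventually_analyticAt
  filter_upwards [Metric.ball_mem_nhds (a, a, b) hε] with x hx
  simp only [← ball_prod_same, Set.mem_prod] at hx hball
  have hseg : AnalyticOnNhd ℂ (fun ζ => p (ζ, x.2.2)) (Metric.ball a ε) := fun z hz =>
    (hball (z, x.2.2) ⟨hz, hx.2.2⟩).along_fst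
  rw [dslope_eq_integral (convex_ball a ε) hseg hx.1 hx.2.1,
    intervalIntegral.integral_of_le zero_le_one]
  refine setIntegral_congr_fun measurableSet_Ioc fun t ht => ?_
  have hz := (convex_ball a ε).add_smul_sub_mem hx.1 hx.2.1 (Ioc_subset_Icc_self ht)
  rw [hM, deriv_comp_prodMk_left (hball (_, x.2.2) ⟨hz, hx.2.2⟩).differentiableAt]

lemma analyticAt_dslope_fst {p : ℂ × E → F} {a c : ℂ} {b : E} (ha : AnalyticAt ℂ p (a, b))
    (hc : AnalyticAt ℂ p (c, b)) :
    AnalyticAt ℂ (fun x : ℂ × ℂ × E => dslope (fun ζ => p (ζ, x.2.2)) x.1 x.2.1) (a, c, b) := by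
  obtain rfl | hca := eq_or_ne c a
  · exact analyticAt_dslope_fst_self hc
  · have hfst : AnalyticAt ℂ (fun x : ℂ × ℂ × E => x.1) (a, c, b) := analyticAt_fst
    have hmid : AnalyticAt ℂ (fun x : ℂ × ℂ × E => x.2.1) (a, c, b) :=
      analyticAt_fst.comp analyticAt_snd
    have hlast : AnalyticAt ℂ (fun x : ℂ × ℂ × E => x.2.2) (a, c, b) :=
      analyticAt_snd.comp analyticAt_snd
    have hslope : AnalyticAt ℂ (fun x : ℂ × ℂ × E =>
        (x.2.1 - x.1)⁻¹ • (p (x.2.1, x.2.2) - p (x.1, x.2.2))) (a, c, b) :=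
      ((hmid.sub hfst).inv (sub_ne_zero.2 hca)).smul
        ((hc.comp₂ hmid hlast).sub (ha.comp₂ hfst hlast))
    refine hslope.congr ?_
    filter_upwards [(isOpen_ne_fun (f := fun x : ℂ × ℂ × E => x.2.1) (g := fun x => x.1)
      (by fun_prop) (by fun_prop)).mem_nhds hca] with x hx
    rw [dslope_of_ne _ hx, slope, vsub_eq_sub]

end DividedDifferences

/-! ### Wirtinger derivatives of holomorphic functions of `w` and `w̄` -/

section Wirtinger

variable {Ψ : ℂ × ℂ → ℂ} {w : ℂ}

lemma clm_apply_eq (L : ℂ × ℂ →L[ℂ] ℂ) (a b : ℂ) : L (a, b) = a * L (1, 0) + b * L (0, 1) := by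
  have : ((a, b) : ℂ × ℂ) = a • (1, 0) + b • (0, 1) := by simp
  rw [this, map_add, map_smul, map_smul, smul_eq_mul, smul_eq_mul]

lemma fderiv_comp_conj_apply (h : DifferentiableAt ℂ Ψ (w, conj w)) (v : ℂ) :
    fderiv ℝ (fun w => Ψ (w, conj w)) w v =
      v * fderiv ℂ Ψ (w, conj w) (1, 0) + conj v * fderiv ℂ Ψ (w, conj w) (0, 1) := by
  have hcomp := (h.hasFDerivAt.restrictScalars ℝ).comp w
    ((hasFDerivAt_id w).prodMk (hasFDerivAt_conj w))
  rw [← clm_apply_eq]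
  exact DFunLike.congr_fun hcomp.fderiv v

lemma dbar_comp_conj (h : DifferentiableAt ℂ Ψ (w, conj w)) :
    dbar (fun w => Ψ (w, conj w)) w = fderiv ℂ Ψ (w, conj w) (0, 1) := by
  simp only [dbar, fderiv_comp_conj_apply h, map_one, Complex.conj_I]
  linear_combination (fderiv ℂ Ψ (w, conj w) (1, 0) - fderiv ℂ Ψ (w, conj w) (0, 1)) / 2 *
    Complex.I_mul_I

lemma dz_comp_conj (h : DifferentiableAt ℂ Ψ (w, conj w)) :
    dz (fun w => Ψ (w, conj w)) w = fderiv ℂ Ψ (w, conj w) (1, 0) := by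
  simp only [dz, fderiv_comp_conj_apply h, map_one, Complex.conj_I]
  linear_combination (fderiv ℂ Ψ (w, conj w) (0, 1) - fderiv ℂ Ψ (w, conj w) (1, 0)) / 2 *
    Complex.I_mul_I

lemma dz_congr {f g : ℂ → ℂ} {z : ℂ} (h : f =ᶠ[𝓝 z] g) : dz f z = dz g z := by
  simp only [dz, h.fderiv_eq]

lemma conj_mem_ball {z₀ : ℂ} {r : ℝ} (hw : w ∈ Metric.ball z₀ r) :
    conj w ∈ Metric.ball (conj z₀) r := by
  rwa [Metric.mem_ball, Complex.dist_conj_conj]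

end Wirtinger

/-! ### Holomorphic functions of `z`, `w` and `w̄` -/

/-- On `U × U`, the function `F(z, w)` is a holomorphic function of `(z, w, w̄)`: the class to
which the phase belongs, closed under algebraic operations and under `∂̄_w`. -/
def IsTriholomorphicOn (U : Set ℂ) (F : ℂ → ℂ → ℂ) : Prop :=
  ∃ Φ : ℂ × ℂ × ℂ → ℂ, ∀ z ∈ U, ∀ w ∈ U,
    AnalyticAt ℂ Φ (z, w, conj w) ∧ F z w = Φ (z, w, conj w)

namespace IsTriholomorphicOn

variable {U : Set ℂ} {F G : ℂ → ℂ → ℂ} {z w : ℂ}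

lemma mul (hF : IsTriholomorphicOn U F) (hG : IsTriholomorphicOn U G) :
    IsTriholomorphicOn U fun z w => F z w * G z w := by
  obtain ⟨Φ, hΦ⟩ := hF
  obtain ⟨Ψ, hΨ⟩ := hG
  exact ⟨fun x => Φ x * Ψ x, fun z hz w hw =>
    ⟨(hΦ z hz w hw).1.mul (hΨ z hz w hw).1, by simp only [(hΦ z hz w hw).2, (hΨ z hz w hw).2]⟩⟩

lemma const_mul (c : ℂ) (hF : IsTriholomorphicOn U F) :
    IsTriholomorphicOn U fun z w => c * F z w := by
  obtain ⟨Φ, hΦ⟩ := hF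
  exact ⟨fun x => c * Φ x, fun z hz w hw =>
    ⟨analyticAt_const.mul (hΦ z hz w hw).1, by simp only [(hΦ z hz w hw).2]⟩⟩

lemma cexp (hF : IsTriholomorphicOn U F) :
    IsTriholomorphicOn U fun z w => Complex.exp (F z w) := by
  obtain ⟨Φ, hΦ⟩ := hF
  exact ⟨fun x => Complex.exp (Φ x), fun z hz w hw =>
    ⟨(hΦ z hz w hw).1.cexp, by simp only [(hΦ z hz w hw).2]⟩⟩

lemma fst_sub_snd : IsTriholomorphicOn U fun z w => z - w :=
  ⟨fun x => x.1 - x.2.1, fun _ _ _ _ =>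
    ⟨analyticAt_fst.sub (analyticAt_fst.comp analyticAt_snd), rfl⟩⟩

lemma continuousOn (hF : IsTriholomorphicOn U F) :
    ContinuousOn (fun x : ℂ × ℂ => F x.1 x.2) (U ×ˢ U) := by
  obtain ⟨Φ, hΦ⟩ := hF
  refine ContinuousOn.congr (f := fun x : ℂ × ℂ => Φ (x.1, x.2, conj x.2)) (fun x hx => ?_)
    fun x hx => (hΦ x.1 hx.1 x.2 hx.2).2
  exact (ContinuousAt.comp (f := fun x : ℂ × ℂ => (x.1, x.2, conj x.2))
    (hΦ x.1 hx.1 x.2 hx.2).1.continuousAt (by fun_prop)).continuousWithinAt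

lemma analyticAt_right (hF : IsTriholomorphicOn U F) (hU : IsOpen U) (hz : z ∈ U) (hw : w ∈ U) :
    AnalyticAt ℝ (F z) w := by
  obtain ⟨Φ, hΦ⟩ := hF
  have hconj : AnalyticAt ℝ (fun w : ℂ => conj w) w := Complex.conjCLE.analyticAt w
  have hcomp : AnalyticAt ℝ (fun w => Φ (z, w, conj w)) w :=
    AnalyticAt.comp (f := fun w : ℂ => (z, w, conj w))
      ((hΦ z hz w hw).1.restrictScalars (𝕜 := ℝ))
      (analyticAt_const.prod (analyticAt_id.prod hconj))
  refine hcomp.congr ?_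
  filter_upwards [hU.mem_nhds hw] with η hη using (hΦ z hz η hη).2.symm

lemma contDiffAt_right (hF : IsTriholomorphicOn U F) (hU : IsOpen U) (hz : z ∈ U) (hw : w ∈ U)
    {n : ℕ∞ω} : ContDiffAt ℝ n (F z) w :=
  (hF.analyticAt_right hU hz hw).contDiffAt

lemma differentiableOn_left (hF : IsTriholomorphicOn U F) (hw : w ∈ U) :
    DifferentiableOn ℂ (fun z => F z w) U := by
  obtain ⟨Φ, hΦ⟩ := hF
  refine DifferentiableOn.congr (f := fun z => Φ (z, w, conj w)) (fun z hz => ?_)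
    fun z hz => (hΦ z hz w hw).2
  exact (DifferentiableAt.comp (g := Φ) (f := fun z => (z, w, conj w)) z
    (hΦ z hz w hw).1.differentiableAt (by fun_prop)).differentiableWithinAt

lemma dbar_right (hF : IsTriholomorphicOn U F) (hU : IsOpen U) :
    IsTriholomorphicOn U fun z w => dbar (F z) w := by
  obtain ⟨Φ, hΦ⟩ := hF
  refine ⟨fun x => fderiv ℂ Φ x (0, 0, 1), fun z hz w hw => ⟨?_, ?_⟩⟩
  · exact ((ContinuousLinearMap.apply ℂ ℂ ((0, 0, 1) : ℂ × ℂ × ℂ)).analyticAt _).comp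
      (hΦ z hz w hw).1.fderiv
  · have hslice := (hΦ z hz w hw).1.differentiableAt.hasFDerivAt.comp (w, conj w)
      ((hasFDerivAt_const z _).prodMk (hasFDerivAt_id _))
    have hev : F z =ᶠ[𝓝 w] fun η => Φ (z, η, conj η) := by
      filter_upwards [hU.mem_nhds hw] with η hη using (hΦ z hz η hη).2
    refine (dbar_congr hev).trans ?_
    rw [dbar_comp_conj (Ψ := fun y => Φ (z, y)) hslice.differentiableAt]
    exact (DFunLike.congr_fun hslice.fderiv _).trans (by simp)

lemma iterate_dbar_right (hF : IsTriholomorphicOn U F) (hU : IsOpen U) (n : ℕ) :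
    IsTriholomorphicOn U fun z w => (dbar^[n] (F z)) w := by
  induction n with
  | zero => exact hF
  | succ n ih => simpa only [Function.iterate_succ_apply'] using ih.dbar_right hU

end IsTriholomorphicOn

/-! ### Regularity of the phase and of the kernel -/

namespace IsPolarization

variable {Q : ℂ → ℝ} {P : ℂ → ℂ → ℂ} {z₀ : ℂ} {r : ℝ} {z w : ℂ}

lemma analyticAt (hP : IsPolarization Q z₀ r P) (hz : z ∈ Metric.ball z₀ r)
    (hw : w ∈ Metric.ball z₀ r) :
    AnalyticAt ℂ (fun p : ℂ × ℂ => P p.1 (conj p.2)) (z, conj w) :=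
  hP.analytic _ ⟨hz, conj_mem_ball hw⟩

lemma dz_eq_deriv (hP : IsPolarization Q z₀ r P) (hz : z ∈ Metric.ball z₀ r) :
    dz (fun ζ => (Q ζ : ℂ)) z = deriv (fun ζ => P ζ z) z := by
  have hdiff := (hP.analyticAt hz hz).differentiableAt
  have hdiag : (fun ζ => (Q ζ : ℂ)) =ᶠ[𝓝 z] fun ζ => P ζ (conj (conj ζ)) := by
    filter_upwards [Metric.isOpen_ball.mem_nhds hz] with ζ hζ
    rw [Complex.conj_conj, hP.diag ζ hζ]
  rw [dz_congr hdiag, dz_comp_conj (Ψ := fun p => P p.1 (conj p.2)) hdiff,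
    ← deriv_comp_prodMk_left (p := fun p : ℂ × ℂ => P p.1 (conj p.2)) hdiff]
  simp only [Complex.conj_conj]

lemma phase_eq_dslope (hP : IsPolarization Q z₀ r P) (hz : z ∈ Metric.ball z₀ r)
    (hw : w ∈ Metric.ball z₀ r) : phase Q P z w = dslope (fun ζ => P ζ w) z w := by
  obtain rfl | hwz := eq_or_ne w z
  · rw [phase, if_pos rfl, dslope_same, hP.dz_eq_deriv hw]
  · rw [phase, if_neg hwz, dslope_of_ne _ hwz, slope_def_field, hP.diag w hw]

lemma isTriholomorphicOn_phase (hP : IsPolarization Q z₀ r P) :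
    IsTriholomorphicOn (Metric.ball z₀ r) (phase Q P) :=
  ⟨fun x => dslope (fun ζ => P ζ (conj x.2.2)) x.1 x.2.1, fun z hz w hw =>
    ⟨analyticAt_dslope_fst (p := fun p : ℂ × ℂ => P p.1 (conj p.2)) (hP.analyticAt hz hw)
      (hP.analyticAt hw hw), by simpa only [Complex.conj_conj] using hP.phase_eq_dslope hz hw⟩⟩

lemma isTriholomorphicOn_expPhase (hP : IsPolarization Q z₀ r P) (m : ℝ) :
    IsTriholomorphicOn (Metric.ball z₀ r) (expPhase m Q P) :=
  ((IsTriholomorphicOn.fst_sub_snd.const_mul (m : ℂ)).mul hP.isTriholomorphicOn_phase).cexp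

end IsPolarization

/-- The coefficient of `(z̄ - w̄)^k` in the kernel `R_{q,m}(z, w)`. -/
def kernelCoeff (q k : ℕ) (m : ℝ) (Q : ℂ → ℝ) (P : ℂ → ℂ → ℂ) (z w : ℂ) : ℂ :=
  (m : ℂ) * ((q ! : ℂ) * (-1) ^ k / (((q - 1 - k)! : ℂ) * ((k + 1)! : ℂ) * (k ! : ℂ))) *
    ((dbar^[k] fun η => dbar (phase Q P z) η * expPhase m Q P z η) w * expPhase (-m) Q P z w)

lemma kernelR_eq_sum_kernelCoeff (q : ℕ) (m : ℝ) (Q : ℂ → ℝ) (P : ℂ → ℂ → ℂ) (z w : ℂ) :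
    kernelR q m Q P z w =
      ∑ k ∈ Finset.range q, kernelCoeff q k m Q P z w * (conj z - conj w) ^ k := by
  rw [kernelR, Finset.mul_sum]
  refine Finset.sum_congr rfl fun k _ => ?_
  simp only [kernelCoeff, expPhase, Complex.ofReal_neg, neg_mul]
  ring

namespace IsPolarization

variable {Q : ℂ → ℝ} {P : ℂ → ℂ → ℂ} {z₀ : ℂ} {r : ℝ} {z w : ℂ}

lemma isTriholomorphicOn_kernelCoeff (hP : IsPolarization Q z₀ r P) (q k : ℕ) (m : ℝ) :
    IsTriholomorphicOn (Metric.ball z₀ r) (kernelCoeff q k m Q P) :=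
  ((((hP.isTriholomorphicOn_phase.dbar_right Metric.isOpen_ball).mul
    (hP.isTriholomorphicOn_expPhase m)).iterate_dbar_right Metric.isOpen_ball k).mul
      (hP.isTriholomorphicOn_expPhase (-m))).const_mul _

lemma analyticOnNhd_kernelR (hP : IsPolarization Q z₀ r P) (q : ℕ) (m : ℝ)
    (hz : z ∈ Metric.ball z₀ r) :
    AnalyticOnNhd ℝ (fun w => kernelR q m Q P z w) (Metric.ball z₀ r) := by
  simp only [kernelR_eq_sum_kernelCoeff]
  refine Finset.analyticOnNhd_fun_sum _ fun k _ w hw => ?_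
  have hconj : AnalyticAt ℝ (fun w : ℂ => conj w) w := Complex.conjCLE.analyticAt w
  exact ((hP.isTriholomorphicOn_kernelCoeff q k m).analyticAt_right Metric.isOpen_ball hz hw).mul
    ((analyticAt_const.sub hconj).pow k)

lemma isPolyanalyticOn_kernelR (hP : IsPolarization Q z₀ r P) (q : ℕ) (m : ℝ)
    (hw : w ∈ Metric.ball z₀ r) :
    IsPolyanalyticOn q (fun z => kernelR q m Q P z w) (Metric.ball z₀ r) := by
  simp only [kernelR_eq_sum_kernelCoeff]
  exact isPolyanalyticOn_sum_mul_conj_sub_pow Metric.isOpen_ball q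
    (fun k => (hP.isTriholomorphicOn_kernelCoeff q k m).differentiableOn_left hw) (conj w)

end IsPolarization

/-! ### The kernel as a derivative -/

section Kernel

variable {Q : ℂ → ℝ} {P : ℂ → ℂ → ℂ} {z₀ : ℂ} {r : ℝ} {z w : ℂ}

lemma sub_mul_phase (hd : P z z = Q z) : (z - w) * phase Q P z w = P z w - Q w := by
  obtain rfl | hwz := eq_or_ne w z
  · simp [hd]
  · have : w - z ≠ 0 := sub_ne_zero.2 hwz
    rw [phase, if_neg hwz]
    field_simp
    ring

lemma expPhase_mul_expPhase_neg (m : ℝ) (Q : ℂ → ℝ) (P : ℂ → ℂ → ℂ) (z w : ℂ) :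
    expPhase m Q P z w * expPhase (-m) Q P z w = 1 := by
  rw [expPhase, expPhase, ← Complex.exp_add, Complex.ofReal_neg, neg_mul, neg_mul, add_neg_cancel,
    Complex.exp_zero]

namespace IsPolarization

lemma dbar_expPhase (hP : IsPolarization Q z₀ r P) (m : ℝ) (hz : z ∈ Metric.ball z₀ r)
    (hw : w ∈ Metric.ball z₀ r) :
    dbar (expPhase m Q P z) w = m * (z - w) * (dbar (phase Q P z) w * expPhase m Q P z w) := by
  have hlin : DifferentiableAt ℂ (fun η => (m : ℂ) * (z - η)) w := by fun_prop
  have hphase : DifferentiableAt ℝ (phase Q P z) w :=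
    (hP.isTriholomorphicOn_phase.analyticAt_right Metric.isOpen_ball hz hw).differentiableAt
  have hexp := dbar_comp_of_hasDerivAt (f := fun η => m * (z - η) * phase Q P z η)
    (Complex.hasDerivAt_exp _) ((hlin.restrictScalars ℝ).fun_mul hphase)
  refine hexp.trans ?_
  rw [dbar_mul (hlin.restrictScalars ℝ) hphase, dbar_eq_zero_of_differentiableAt hlin,
    expPhase]
  ring

lemma iterate_dbar_succ_expPhase (hP : IsPolarization Q z₀ r P) (m : ℝ)
    (hz : z ∈ Metric.ball z₀ r) (hw : w ∈ Metric.ball z₀ r) (k : ℕ) :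
    (dbar^[k + 1] (expPhase m Q P z)) w =
      m * (z - w) * (dbar^[k] fun η => dbar (phase Q P z) η * expPhase m Q P z η) w := by
  have hlin : AnalyticAt ℂ (fun η => (m : ℂ) * (z - η)) w :=
    analyticAt_const.mul (analyticAt_const.sub analyticAt_id)
  have hev : dbar (expPhase m Q P z) =ᶠ[𝓝 w]
      fun η => m * (z - η) * (dbar (phase Q P z) η * expPhase m Q P z η) := by
    filter_upwards [Metric.isOpen_ball.mem_nhds hw] with η hη using hP.dbar_expPhase m hz hη
  rw [Function.iterate_succ_apply, iterate_dbar_congr hev, iterate_dbar_holomorphic_mul hlin]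
  exact ((hP.isTriholomorphicOn_phase.dbar_right Metric.isOpen_ball).mul
    (hP.isTriholomorphicOn_expPhase m)).contDiffAt_right Metric.isOpen_ball hz hw

end IsPolarization

lemma factorial_div_eq_choose_mul_descFactorial {n k : ℕ} (hk : k ≤ n) :
    (n ! : ℂ) * ((n + 1)! / ((n - k)! * (k + 1)! * k !)) =
      (n + 1).choose (k + 1) * n.descFactorial (n - k) := by
  have hdesc : (k ! : ℂ) * n.descFactorial (n - k) = n ! := by
    have := Nat.factorial_mul_descFactorial (Nat.sub_le n k)
    rw [Nat.sub_sub_self hk] at this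
    exact_mod_cast this
  have hchoose : ((n + 1).choose (k + 1) : ℂ) * (k + 1)! * (n - k)! = (n + 1)! := by
    have := Nat.choose_mul_factorial_mul_factorial (Nat.succ_le_succ hk)
    rw [Nat.succ_sub_succ] at this
    exact_mod_cast this
  have h₁ : (k ! : ℂ) ≠ 0 := by exact_mod_cast k.factorial_ne_zero
  have h₂ : ((k + 1)! : ℂ) ≠ 0 := by exact_mod_cast (k + 1).factorial_ne_zero
  have h₃ : ((n - k)! : ℂ) ≠ 0 := by exact_mod_cast (n - k).factorial_ne_zero
  rw [← hdesc, ← hchoose]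
  field_simp

lemma iterate_dbar_succ_conj_sub_pow_mul_reflect {n : ℕ} {f : ℂ → ℂ}
    (hf : ContDiffAt ℝ (n + 1 : ℕ) f w) (c : ℂ) :
    (dbar^[n + 1] fun η => (conj η - c) ^ n * f η) w =
      ∑ k ∈ Finset.range (n + 1), (n + 1).choose (k + 1) *
        (n.descFactorial (n - k) * (conj w - c) ^ k * (dbar^[k + 1] f) w) := by
  rw [iterate_dbar_succ_conj_sub_pow_mul n hf, ← Finset.sum_range_reflect]
  refine Finset.sum_congr rfl fun k hk => ?_
  have hkn : k ≤ n := Nat.lt_succ_iff.1 (Finset.mem_range.1 hk)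
  have h₁ : n + 1 - 1 - k = n - k := rfl
  have h₂ : n + 1 - (n - k) = k + 1 := by omega
  have h₃ : n - (n - k) = k := Nat.sub_sub_self hkn
  have h₄ : (n + 1).choose (n - k) = (n + 1).choose (k + 1) :=
    Nat.choose_symm_of_eq_add (by omega)
  rw [h₁, iterate_dbar_conj_sub_pow, h₂, h₃, h₄]

lemma IsPolarization.factorial_mul_sub_mul_kernelR_mul_expPhase (hP : IsPolarization Q z₀ r P)
    (n : ℕ) (m : ℝ) (hz : z ∈ Metric.ball z₀ r) (hw : w ∈ Metric.ball z₀ r) :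
    n ! * (z - w) * (kernelR (n + 1) m Q P z w * expPhase m Q P z w) =
      (dbar^[n + 1] fun η => (conj η - conj z) ^ n * expPhase m Q P z η) w := by
  rw [iterate_dbar_succ_conj_sub_pow_mul_reflect
    ((hP.isTriholomorphicOn_expPhase m).contDiffAt_right Metric.isOpen_ball hz hw),
    kernelR_eq_sum_kernelCoeff, Finset.sum_mul, Finset.mul_sum]
  refine Finset.sum_congr rfl fun k hk => ?_
  have hkn : k ≤ n := Nat.lt_succ_iff.1 (Finset.mem_range.1 hk)
  have hsign : (-1 : ℂ) ^ k * (conj z - conj w) ^ k = (conj w - conj z) ^ k := by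
    rw [← mul_pow, neg_one_mul, neg_sub]
  rw [hP.iterate_dbar_succ_expPhase m hz hw, ← hsign, kernelCoeff, Nat.add_sub_cancel]
  generalize (dbar^[k] fun η => dbar (phase Q P z) η * expPhase m Q P z η) w = D
  linear_combination (m * (z - w) * (-1) ^ k * (conj z - conj w) ^ k * D) *
    ((n ! * ((n + 1)! / ((n - k)! * (k + 1)! * k !))) * expPhase_mul_expPhase_neg m Q P z w +
      factorial_div_eq_choose_mul_descFactorial hkn)

end Kernel

/-! ### Uniform estimates -/

namespace IsTriholomorphicOn

variable {U K L : Set ℂ} {A f : ℂ → ℂ → ℂ} {z w : ℂ}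

lemma exists_norm_le (hA : IsTriholomorphicOn U A) (hK : IsCompact K) (hL : IsCompact L)
    (hKU : K ⊆ U) (hLU : L ⊆ U) : ∃ C : ℝ, 0 ≤ C ∧ ∀ z ∈ K, ∀ w ∈ L, ‖A z w‖ ≤ C := by
  obtain ⟨C, hC⟩ := (hK.prod hL).exists_bound_of_continuousOn
    (hA.continuousOn.mono (prod_mono hKU hLU))
  exact ⟨max C 0, le_max_right _ _, fun z hz w hw => (hC (z, w) ⟨hz, hw⟩).trans (le_max_left _ _)⟩

lemma mul_exp (hA : IsTriholomorphicOn U A) (hf : IsTriholomorphicOn U f) (m : ℂ) :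
    IsTriholomorphicOn U fun z w => A z w * Complex.exp (m * f z w) :=
  hA.mul (hf.const_mul m).cexp

lemma dbar_mul_exp (hA : IsTriholomorphicOn U A) (hf : IsTriholomorphicOn U f) (hU : IsOpen U)
    (hz : z ∈ U) (hw : w ∈ U) (m : ℂ) :
    dbar (fun η => A z η * Complex.exp (m * f z η)) w =
      dbar (A z) w * Complex.exp (m * f z w) +
        m * (A z w * dbar (f z) w * Complex.exp (m * f z w)) := by
  have hexp := dbar_comp_of_hasDerivAt (f := fun η => m * f z η) (Complex.hasDerivAt_exp _)
    ((hf.const_mul m).analyticAt_right hU hz hw).differentiableAt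
  rw [dbar_mul (hA.analyticAt_right hU hz hw).differentiableAt
    ((hf.const_mul m).cexp.analyticAt_right hU hz hw).differentiableAt, hexp, dbar_const_mul]
  ring

lemma iterate_dbar_succ_mul_exp (hA : IsTriholomorphicOn U A) (hf : IsTriholomorphicOn U f)
    (hU : IsOpen U) (hz : z ∈ U) (hw : w ∈ U) (m : ℂ) (j : ℕ) :
    (dbar^[j + 1] fun η => A z η * Complex.exp (m * f z η)) w =
      (dbar^[j] fun η => dbar (A z) η * Complex.exp (m * f z η)) w +
        m * (dbar^[j] fun η => A z η * dbar (f z) η * Complex.exp (m * f z η)) w := by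
  have hev : dbar (fun η => A z η * Complex.exp (m * f z η)) =ᶠ[𝓝 w] _ :=
    (hU.mem_nhds hw |> mem_of_superset <| fun η hη => hA.dbar_mul_exp hf hU hz hη m)
  rw [Function.iterate_succ_apply, iterate_dbar_congr hev, iterate_dbar_add
    (((hA.dbar_right hU).mul_exp hf m).contDiffAt_right hU hz hw)
    ((((hA.mul (hf.dbar_right hU)).mul_exp hf m).const_mul m).contDiffAt_right hU hz hw),
    iterate_dbar_const_mul]

lemma exists_norm_iterate_dbar_mul_exp_le (hA : IsTriholomorphicOn U A)
    (hf : IsTriholomorphicOn U f) (hU : IsOpen U) (hK : IsCompact K) (hL : IsCompact L)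
    (hKU : K ⊆ U) (hLU : L ⊆ U) (j : ℕ) :
    ∃ C : ℝ, 0 ≤ C ∧ ∀ m : ℝ, 1 ≤ m → ∀ z ∈ K, ∀ w ∈ L,
      ‖(dbar^[j] fun η => A z η * Complex.exp (m * f z η)) w‖ ≤
        C * m ^ j * ‖Complex.exp (m * f z w)‖ := by
  induction j generalizing A with
  | zero =>
    obtain ⟨C, hC, hAC⟩ := hA.exists_norm_le hK hL hKU hLU
    refine ⟨C, hC, fun m _ z hz w hw => ?_⟩
    rw [Function.iterate_zero_apply, norm_mul, pow_zero, mul_one]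
    exact mul_le_mul_of_nonneg_right (hAC z hz w hw) (norm_nonneg _)
  | succ j ih =>
    obtain ⟨C₁, hC₁, h₁⟩ := ih (hA.dbar_right hU)
    obtain ⟨C₂, hC₂, h₂⟩ := ih (hA.mul (hf.dbar_right hU))
    refine ⟨C₁ + C₂, by positivity, fun m hm z hz w hw => ?_⟩
    rw [hA.iterate_dbar_succ_mul_exp hf hU (hKU hz) (hLU hw)]
    calc _ ≤ C₁ * m ^ j * ‖Complex.exp (m * f z w)‖ +
          m * (C₂ * m ^ j * ‖Complex.exp (m * f z w)‖) := by
          refine norm_add_le_of_le (h₁ m hm z hz w hw) ?_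
          rw [norm_mul, Complex.norm_real, Real.norm_of_nonneg (by linarith)]
          exact mul_le_mul_of_nonneg_left (h₂ m hm z hz w hw) (by linarith)
      _ ≤ C₁ * m ^ (j + 1) * ‖Complex.exp (m * f z w)‖ +
          m * (C₂ * m ^ j * ‖Complex.exp (m * f z w)‖) := by
          gcongr
          omega
      _ = (C₁ + C₂) * m ^ (j + 1) * ‖Complex.exp (m * f z w)‖ := by ring

lemma exists_forall_norm_iterate_dbar_mul_exp_le (hA : IsTriholomorphicOn U A)
    (hf : IsTriholomorphicOn U f) (hU : IsOpen U) (hK : IsCompact K) (hL : IsCompact L)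
    (hKU : K ⊆ U) (hLU : L ⊆ U) (n : ℕ) :
    ∃ C : ℝ, 0 ≤ C ∧ ∀ j ≤ n, ∀ m : ℝ, 1 ≤ m → ∀ z ∈ K, ∀ w ∈ L,
      ‖(dbar^[j] fun η => A z η * Complex.exp (m * f z η)) w‖ ≤
        C * m ^ n * ‖Complex.exp (m * f z w)‖ := by
  choose C hC hbound using hA.exists_norm_iterate_dbar_mul_exp_le hf hU hK hL hKU hLU
  refine ⟨∑ j ∈ Finset.range (n + 1), C j, Finset.sum_nonneg fun j _ => hC j,
    fun j hj m hm z hz w hw => (hbound j m hm z hz w hw).trans ?_⟩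
  gcongr
  · exact Finset.sum_nonneg fun j _ => hC j
  · exact Finset.single_le_sum (fun j _ => hC j) (Finset.mem_range.2 (Nat.lt_succ_iff.2 hj))

end IsTriholomorphicOn

/-! ### The approximate reproducing identity -/

lemma norm_iterate_dbar_conj_sub_pow_le {c w : ℂ} {D : ℝ} (hD : 1 ≤ D) (hwD : ‖conj w - c‖ ≤ D)
    (n i : ℕ) : ‖(dbar^[i] fun η => (conj η - c) ^ n) w‖ ≤ n ! * D ^ n := by
  have hdesc : (n.descFactorial i : ℝ) ≤ n ! := by
    obtain hi | hi := le_or_gt i n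
    · exact_mod_cast Nat.le_of_dvd n.factorial_pos
        ⟨_, (Nat.factorial_mul_descFactorial hi).symm.trans (mul_comm _ _)⟩
    · simp [Nat.descFactorial_of_lt hi]
  rw [iterate_dbar_conj_sub_pow, norm_mul, norm_pow, Complex.norm_natCast]
  gcongr
  calc ‖conj w - c‖ ^ (n - i) ≤ D ^ (n - i) := by gcongr
    _ ≤ D ^ n := pow_le_pow_right₀ hD (Nat.sub_le n i)

lemma exists_norm_iterate_dbar_le {χ : ℂ → ℂ} (hχ : ContDiff ℝ ∞ χ) (hχc : HasCompactSupport χ)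
    (n : ℕ) : ∃ C : ℝ, ∀ w, ‖(dbar^[n] χ) w‖ ≤ C :=
  (contDiff_iterate_dbar hχ n).continuous.bounded_above_of_compact_support
    (hχc.mono' ((subset_tsupport _).trans (tsupport_iterate_dbar_subset χ n)))

lemma pow_mul_exp_neg_mul_le {δ m : ℝ} (hδ : 0 < δ) (hm : 0 ≤ m) (k : ℕ) :
    m ^ k * Real.exp (-(δ * m)) ≤ k ! / δ ^ k := by
  have h := Real.pow_div_factorial_le_exp (δ * m) (by positivity) k
  rw [Real.exp_neg, ← div_eq_mul_inv, div_le_div_iff₀ (Real.exp_pos _) (by positivity), ← mul_pow,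
    mul_comm m]
  rwa [div_le_iff₀ (by positivity), mul_comm (Real.exp _)] at h

lemma setIntegral_le_sqrt_mul_sqrt {α : Type*} [MeasurableSpace α] {μ : Measure α} {s : Set α}
    (hs : μ s ≠ ⊤) {v : α → ℝ} (hv : AEStronglyMeasurable v (μ.restrict s)) (hv0 : ∀ w, 0 ≤ v w)
    (hvi : IntegrableOn (fun w => v w ^ 2) s μ) :
    IntegrableOn v s μ ∧ ∫ w in s, v w ∂μ ≤ √(∫ w in s, v w ^ 2 ∂μ) * √(μ.real s) := by
  have : IsFiniteMeasure (μ.restrict s) := ⟨by simpa using hs.lt_top⟩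
  have hL2 : MemLp v 2 (μ.restrict s) := (memLp_two_iff_integrable_sq hv).2 hvi
  refine ⟨hL2.integrable one_le_two, ?_⟩
  have h := integral_mul_le_Lp_mul_Lq_of_nonneg Real.HolderConjugate.two_two
    (μ := μ.restrict s) (f := v) (g := fun _ => 1) (.of_forall hv0)
    (.of_forall fun _ => zero_le_one) (by simpa using hL2) (memLp_const 1)
  simpa only [mul_one, ← Real.sqrt_eq_rpow, Real.rpow_ofNat, one_pow, setIntegral_const,
    smul_eq_mul] using h

lemma exp_neg_mul_div_two_sq (m t : ℝ) : Real.exp (-m * t / 2) ^ 2 = Real.exp (-m * t) := by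
  rw [← Real.exp_nat_mul]
  congr 1
  push_cast
  ring

/-- The error made by replacing `∂̄^(n + 1) (χ (w̄ - z̄)^n e^{m(z-w)θ})` with
`χ ∂̄^(n + 1) ((w̄ - z̄)^n e^{m(z-w)θ})`. -/
def cutoffError (n : ℕ) (m : ℝ) (Q : ℂ → ℝ) (P : ℂ → ℂ → ℂ) (χ : ℂ → ℂ) (z w : ℂ) : ℂ :=
  dbarComm (n + 1) χ (fun η => (conj η - conj z) ^ n * expPhase m Q P z η) w

namespace IsPolarization

variable {Q : ℂ → ℝ} {P : ℂ → ℂ → ℂ} {z₀ : ℂ} {r c : ℝ} {χ u : ℂ → ℂ} {z w : ℂ}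

lemma continuousOn (hP : IsPolarization Q z₀ r P) : ContinuousOn Q (Metric.ball z₀ r) := by
  have h : ContinuousOn (fun ζ => (P ζ ζ).re) (Metric.ball z₀ r) := fun ζ hζ => by
    have hPζ : ContinuousAt (fun ζ : ℂ => P ζ (conj (conj ζ))) ζ :=
      ContinuousAt.comp (g := fun p : ℂ × ℂ => P p.1 (conj p.2)) (f := fun ζ => (ζ, conj ζ))
        (hP.analyticAt hζ hζ).continuousAt (by fun_prop)
    simp only [Complex.conj_conj] at hPζ
    exact (Complex.continuous_re.continuousAt.comp hPζ).continuousWithinAt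
  exact h.congr fun ζ hζ => by simp only [hP.diag ζ hζ, Complex.ofReal_re]

lemma norm_expPhase_le (hP : IsPolarization Q z₀ r P)
    (hbound : ∀ z ∈ Metric.ball z₀ r, ∀ w ∈ Metric.ball z₀ r,
      2 * (P z w).re - Q w - Q z ≤ -c * ‖w - z‖ ^ 2)
    {m : ℝ} (hm : 0 ≤ m) (hz : z ∈ Metric.ball z₀ r) (hw : w ∈ Metric.ball z₀ r) :
    ‖expPhase m Q P z w‖ ≤
      Real.exp (m * Q z / 2) * Real.exp (-(c * ‖w - z‖ ^ 2 / 2 * m)) * Real.exp (-m * Q w / 2) := by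
  rw [expPhase, mul_assoc, sub_mul_phase (hP.diag z hz), Complex.norm_exp, ← Real.exp_add,
    ← Real.exp_add, Complex.re_ofReal_mul, Complex.sub_re, Complex.ofReal_re]
  refine Real.exp_le_exp.2 ?_
  linarith [mul_le_mul_of_nonneg_left (hbound z hz w hw) hm]

lemma exists_norm_iterate_dbar_pow_mul_expPhase_le (hP : IsPolarization Q z₀ r P) (n : ℕ)
    {K L : Set ℂ} (hK : IsCompact K) (hL : IsCompact L) (hKU : K ⊆ Metric.ball z₀ r)
    (hLU : L ⊆ Metric.ball z₀ r) :
    ∃ C : ℝ, 0 ≤ C ∧ ∀ j ≤ n, ∀ m : ℝ, 1 ≤ m → ∀ z ∈ K, ∀ w ∈ L,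
      ‖(dbar^[j] fun η => (conj η - conj z) ^ n * expPhase m Q P z η) w‖ ≤
        C * m ^ n * ‖expPhase m Q P z w‖ := by
  obtain ⟨C, hC, hE⟩ := (show IsTriholomorphicOn (Metric.ball z₀ r) fun _ _ => 1 from
    ⟨fun _ => 1, fun _ _ _ _ => ⟨analyticAt_const, rfl⟩⟩).exists_forall_norm_iterate_dbar_mul_exp_le
      (IsTriholomorphicOn.fst_sub_snd.mul hP.isTriholomorphicOn_phase) Metric.isOpen_ball hK hL
      hKU hLU n
  simp only [one_mul, ← mul_assoc] at hE
  obtain ⟨D, hD⟩ := (hK.prod hL).exists_bound_of_continuousOn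
    (f := fun x : ℂ × ℂ => conj x.2 - conj x.1) (by fun_prop)
  refine ⟨2 ^ n * (n ! * max 1 D ^ n * C), by positivity, fun j hj m hm z hz w hw => ?_⟩
  have hpow := norm_iterate_dbar_conj_sub_pow_le (le_max_left 1 D)
    ((hD (z, w) ⟨hz, hw⟩).trans (le_max_right 1 D)) n
  calc _ ≤ 2 ^ j * (n ! * max 1 D ^ n * (C * m ^ n * ‖expPhase m Q P z w‖)) :=
        norm_iterate_dbar_mul_le (by positivity) ((contDiff_conj_sub_const _).pow n).contDiffAt
          ((hP.isTriholomorphicOn_expPhase m).contDiffAt_right Metric.isOpen_ball (hKU hz) (hLU hw))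
          (fun i _ => hpow i) fun i hi => hE i (hi.trans hj) m hm z hz w hw
    _ ≤ 2 ^ n * (n ! * max 1 D ^ n * (C * m ^ n * ‖expPhase m Q P z w‖)) := by
        gcongr
        exact one_le_two
    _ = _ := by ring

lemma exists_norm_cutoffError_le (hP : IsPolarization Q z₀ r P) (n : ℕ) (hχ : ContDiff ℝ ∞ χ)
    (hχc : HasCompactSupport χ) (hχU : tsupport χ ⊆ Metric.ball z₀ r) {K : Set ℂ}
    (hK : IsCompact K) (hKU : K ⊆ Metric.ball z₀ r) :
    ∃ C : ℝ, 0 ≤ C ∧ ∀ m : ℝ, 1 ≤ m → ∀ z ∈ K, ∀ w ∈ tsupport χ,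
      ‖cutoffError n m Q P χ z w‖ ≤ C * m ^ n * ‖expPhase m Q P z w‖ := by
  obtain ⟨C, hC, hE⟩ :=
    hP.exists_norm_iterate_dbar_pow_mul_expPhase_le n hK hχc.isCompact hKU hχU
  choose N hN using exists_norm_iterate_dbar_le hχ hχc
  have hN0 (j : ℕ) : 0 ≤ N j := (norm_nonneg _).trans (hN j 0)
  refine ⟨∑ i ∈ Finset.range (n + 1), (n + 1).choose i * (C * N (n + 1 - i)),
    Finset.sum_nonneg fun i _ => mul_nonneg (Nat.cast_nonneg _) (mul_nonneg hC (hN0 _)),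
    fun m hm z hz w hw => ?_⟩
  rw [cutoffError, dbarComm_eq_sum (hχ.of_le (by exact_mod_cast le_top)).contDiffAt
    (((contDiff_conj_sub_const _).pow n).contDiffAt.mul
      ((hP.isTriholomorphicOn_expPhase m).contDiffAt_right Metric.isOpen_ball (hKU hz) (hχU hw))),
    Finset.sum_mul, Finset.sum_mul]
  refine norm_sum_le_of_le _ fun i hi => ?_
  rw [norm_mul, norm_mul, Complex.norm_natCast]
  calc _ ≤ (n + 1).choose i * (C * m ^ n * ‖expPhase m Q P z w‖ * N (n + 1 - i)) := by
        gcongr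
        · exact hE i (Nat.lt_succ_iff.1 (Finset.mem_range.1 hi)) m hm z hz w hw
        · exact hN _ w
    _ = _ := by ring

lemma exists_norm_inv_mul_cutoffError_le (hP : IsPolarization Q z₀ r P)
    (hbound : ∀ z ∈ Metric.ball z₀ r, ∀ w ∈ Metric.ball z₀ r,
      2 * (P z w).re - Q w - Q z ≤ -c * ‖w - z‖ ^ 2) (hc : 0 < c) (n : ℕ) (hχ : ContDiff ℝ ∞ χ)
    (hχc : HasCompactSupport χ) (hχU : tsupport χ ⊆ Metric.ball z₀ r) {K : Set ℂ}
    (hK : IsCompact K) (hKU : K ⊆ Metric.ball z₀ r) {d : ℝ} (hd : 0 < d)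
    (hχK : ∀ z ∈ K, ∀ w, ‖w - z‖ < d → χ =ᶠ[𝓝 w] 1) :
    ∃ C : ℝ, 0 ≤ C ∧ ∀ m : ℝ, 1 ≤ m → ∀ z ∈ K, ∀ w ∈ tsupport χ,
      ‖(w - z)⁻¹ * cutoffError n m Q P χ z w‖ ≤
        C * Real.exp (m * Q z / 2 - c * d ^ 2 / 4 * m) * Real.exp (-m * Q w / 2) := by
  obtain ⟨C, hC, hE⟩ := hP.exists_norm_cutoffError_le n hχ hχc hχU hK hKU
  set δ : ℝ := c * d ^ 2 / 4 with hδ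
  have hδ0 : 0 < δ := by positivity
  refine ⟨d⁻¹ * C * (n ! / δ ^ n), by positivity, fun m hm z hz w hw => ?_⟩
  obtain hwz | hwz := lt_or_ge ‖w - z‖ d
  · rw [cutoffError, dbarComm_eq_zero_of_eventuallyEq_const (hχK z hz w hwz), mul_zero, norm_zero]
    positivity
  have hm0 : 0 ≤ m := zero_le_one.trans hm
  have hdecay : c * ‖w - z‖ ^ 2 / 2 * m ≥ δ * m + δ * m := by
    have : d ^ 2 ≤ ‖w - z‖ ^ 2 := by gcongr
    nlinarith [mul_nonneg hc.le hm0]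
  rw [norm_mul, norm_inv]
  calc ‖w - z‖⁻¹ * ‖cutoffError n m Q P χ z w‖
      ≤ d⁻¹ * (C * m ^ n * (Real.exp (m * Q z / 2) * Real.exp (-(δ * m + δ * m)) *
          Real.exp (-m * Q w / 2))) := by
        gcongr
        refine (hE m hm z hz w hw).trans ?_
        gcongr
        refine (hP.norm_expPhase_le hbound hm0 (hKU hz) (hχU hw)).trans ?_
        gcongr
    _ = d⁻¹ * C * (m ^ n * Real.exp (-(δ * m))) * Real.exp (m * Q z / 2 - δ * m) *
          Real.exp (-m * Q w / 2) := by
        rw [neg_add, Real.exp_add, sub_eq_add_neg, Real.exp_add]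
        ring
    _ ≤ _ := by
        gcongr
        exact pow_mul_exp_neg_mul_le hδ0 hm0 n

lemma contDiff_mul_expPhase (hP : IsPolarization Q z₀ r P) (hχ : ContDiff ℝ ∞ χ)
    (hχU : tsupport χ ⊆ Metric.ball z₀ r) (m : ℝ) (hz : z ∈ Metric.ball z₀ r) :
    ContDiff ℝ ∞ fun w => χ w * expPhase m Q P z w := by
  refine contDiff_iff_contDiffAt.2 fun w => ?_
  by_cases hw : w ∈ tsupport χ
  · exact hχ.contDiffAt.mul
      ((hP.isTriholomorphicOn_expPhase m).contDiffAt_right Metric.isOpen_ball hz (hχU hw))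
  · refine (contDiffAt_const (c := (0 : ℂ))).congr_of_eventuallyEq ?_
    filter_upwards [notMem_tsupport_iff_eventuallyEq.1 hw] with η hη
    rw [hη, Pi.zero_apply, zero_mul]

lemma integrable_mul_kernelR (hP : IsPolarization Q z₀ r P)
    (hu : ContinuousOn u (Metric.ball z₀ r)) (hχ : Continuous χ) (hχc : HasCompactSupport χ)
    (hχU : tsupport χ ⊆ Metric.ball z₀ r) (q : ℕ) (m : ℝ) (hz : z ∈ Metric.ball z₀ r) :
    Integrable (fun w => u w * χ w * kernelR q m Q P z w * expPhase m Q P z w) area := by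
  have hE : ContinuousOn (expPhase m Q P z) (Metric.ball z₀ r) := fun w hw =>
    ((hP.isTriholomorphicOn_expPhase m).analyticAt_right
      Metric.isOpen_ball hz hw).continuousAt.continuousWithinAt
  refine ((integrable_area_iff.2 (integrable_mul_of_tsupport_subset Metric.isOpen_ball
    ((hu.mul (hP.analyticOnNhd_kernelR q m hz).continuousOn).mul hE) hχ hχc hχU)).congr
      (.of_forall fun w => ?_))
  simp only [Pi.mul_apply]
  ring

lemma inv_mul_iterate_dbar_eq (hP : IsPolarization Q z₀ r P)
    (hχU : tsupport χ ⊆ Metric.ball z₀ r) (n : ℕ) (m : ℝ) (hz : z ∈ Metric.ball z₀ r)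
    (hwz : w ≠ z) :
    (w - z)⁻¹ * (dbar^[n + 1] fun η => (conj η - conj z) ^ n * (χ η * expPhase m Q P z η)) w =
      (w - z)⁻¹ * cutoffError n m Q P χ z w -
        n ! * (χ w * (kernelR (n + 1) m Q P z w * expPhase m Q P z w)) := by
  simp only [cutoffError, dbarComm, mul_left_comm _ (χ _)]
  by_cases hw : w ∈ Metric.ball z₀ r
  · rw [← hP.factorial_mul_sub_mul_kernelR_mul_expPhase n m hz hw]
    have : w - z ≠ 0 := sub_ne_zero.2 hwz
    field_simp
    ring
  · rw [image_eq_zero_of_notMem_tsupport fun h => hw (hχU h)]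
    ring

lemma factorial_mul_sub_integral_eq (hP : IsPolarization Q z₀ r P) (n : ℕ) (m : ℝ)
    (hu : IsPolyanalyticOn (n + 1) u (Metric.ball z₀ r)) (hχ : ContDiff ℝ ∞ χ)
    (hχc : HasCompactSupport χ) (hχU : tsupport χ ⊆ Metric.ball z₀ r)
    (hz : z ∈ Metric.ball z₀ r) :
    n ! * (u z * χ z - ∫ w in Metric.ball z₀ r,
      u w * χ w * kernelR (n + 1) m Q P z w * expPhase m Q P z w ∂area) =
        -∫ w, u w * ((w - z)⁻¹ * cutoffError n m Q P χ z w) ∂area := by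
  have hkernel := hP.integrable_mul_kernelR hu.1 hχ.continuous hχc hχU (n + 1) m hz
  obtain ⟨hint, hcauchy⟩ := hu.integral_mul_iterate_dbar Metric.isOpen_ball
    (hP.contDiff_mul_expPhase hχ hχU m hz) hχc.mul_right
    (tsupport_mul_subset_left.trans hχU) z
  have hsplit : (fun w => u w * ((w - z)⁻¹ * cutoffError n m Q P χ z w)) =ᵐ[area] fun w =>
      u w * ((w - z)⁻¹ *
        (dbar^[n + 1] fun η => (conj η - conj z) ^ n * (χ η * expPhase m Q P z η)) w) +
      n ! * (u w * χ w * kernelR (n + 1) m Q P z w * expPhase m Q P z w) := by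
    filter_upwards [Measure.ae_ne area z] with w hwz
    rw [hP.inv_mul_iterate_dbar_eq hχU n m hz hwz]
    ring
  have hball : ∫ w in Metric.ball z₀ r,
      u w * χ w * kernelR (n + 1) m Q P z w * expPhase m Q P z w ∂area =
        ∫ w, u w * χ w * kernelR (n + 1) m Q P z w * expPhase m Q P z w ∂area :=
    setIntegral_eq_integral_of_forall_compl_eq_zero fun w hw => by
      simp [image_eq_zero_of_notMem_tsupport fun h => hw (hχU h)]
  have hone : expPhase m Q P z z = 1 := by simp [expPhase]
  rw [hball, integral_congr_ae hsplit, integral_add hint (hkernel.const_mul _), integral_const_mul,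
    hcauchy, hone]
  ring

lemma norm_integral_mul_cutoffError_le (hP : IsPolarization Q z₀ r P) (n : ℕ) {m B : ℝ}
    (hu : ContinuousOn u (Metric.ball z₀ r))
    (hui : IntegrableOn (fun w => ‖u w‖ ^ 2 * Real.exp (-m * Q w)) (Metric.ball z₀ r) area)
    (hχc : HasCompactSupport χ) (hχU : tsupport χ ⊆ Metric.ball z₀ r) (hB : 0 ≤ B)
    (hbound : ∀ w ∈ tsupport χ,
      ‖(w - z)⁻¹ * cutoffError n m Q P χ z w‖ ≤ B * Real.exp (-m * Q w / 2)) :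
    ‖∫ w, u w * ((w - z)⁻¹ * cutoffError n m Q P χ z w) ∂area‖ ≤
      B * (√(∫ w in Metric.ball z₀ r, ‖u w‖ ^ 2 * Real.exp (-m * Q w) ∂area) *
        √(area.real (tsupport χ))) := by
  have hχm := (isClosed_tsupport χ).measurableSet
  have hsq (w : ℂ) : (‖u w‖ * Real.exp (-m * Q w / 2)) ^ 2 = ‖u w‖ ^ 2 * Real.exp (-m * Q w) := by
    rw [mul_pow, exp_neg_mul_div_two_sq]
  have hv : ContinuousOn (fun w => ‖u w‖ * Real.exp (-m * Q w / 2)) (tsupport χ) :=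
    (hu.norm.mul (((hP.continuousOn.const_mul (-m)).div_const 2).rexp)).mono hχU
  obtain ⟨hvi, hcs⟩ := setIntegral_le_sqrt_mul_sqrt hχc.isCompact.measure_lt_top.ne
    (hv.aestronglyMeasurable hχm) (fun w => by positivity)
    (by simpa only [hsq] using hui.mono_set hχU)
  have hzero : ∀ w ∉ tsupport χ, u w * ((w - z)⁻¹ * cutoffError n m Q P χ z w) = 0 := fun w hw => by
    rw [cutoffError, dbarComm_eq_zero_of_notMem_tsupport hw, mul_zero, mul_zero]
  rw [← setIntegral_eq_integral_of_forall_compl_eq_zero hzero]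
  calc _ ≤ ∫ w in tsupport χ, B * (‖u w‖ * Real.exp (-m * Q w / 2)) ∂area := by
        refine norm_integral_le_of_norm_le (hvi.const_mul B) ((ae_restrict_iff' hχm).2
          (.of_forall fun w hw => ?_))
        rw [norm_mul, mul_left_comm]
        exact mul_le_mul_of_nonneg_left (hbound w hw) (norm_nonneg _)
    _ ≤ _ := by
        rw [integral_const_mul]
        refine mul_le_mul_of_nonneg_left (hcs.trans ?_) hB
        simp only [hsq]
        gcongr
        exact .of_forall fun w => by positivity

theorem exists_norm_sub_integral_le (hP : IsPolarization Q z₀ r P)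
    (hbound : ∀ z ∈ Metric.ball z₀ r, ∀ w ∈ Metric.ball z₀ r,
      2 * (P z w).re - Q w - Q z ≤ -c * ‖w - z‖ ^ 2) (hc : 0 < c) (n : ℕ) (hχ : ContDiff ℝ ∞ χ)
    (hχc : HasCompactSupport χ) (hχU : tsupport χ ⊆ Metric.ball z₀ r) {K : Set ℂ}
    (hK : IsCompact K) (hχK : ∀ z ∈ K, χ =ᶠ[𝓝 z] 1) :
    ∃ δ : ℝ, 0 < δ ∧ ∃ C : ℝ, 0 < C ∧ ∀ m : ℝ, 1 ≤ m → ∀ u : ℂ → ℂ,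
      IsPolyanalyticOn (n + 1) u (Metric.ball z₀ r) →
      IntegrableOn (fun w => ‖u w‖ ^ 2 * Real.exp (-m * Q w)) (Metric.ball z₀ r) area →
      ∀ z ∈ K, ‖u z - ∫ w in Metric.ball z₀ r,
          u w * χ w * kernelR (n + 1) m Q P z w * expPhase m Q P z w ∂area‖ ≤
        C * √(∫ w in Metric.ball z₀ r, ‖u w‖ ^ 2 * Real.exp (-m * Q w) ∂area) *
          Real.exp (m * Q z / 2 - δ * m) := by
  have hKU : K ⊆ Metric.ball z₀ r := fun z hz => hχU (subset_tsupport χ (by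
    simp [(hχK z hz).eq_of_nhds]))
  obtain ⟨d, hd, hdK⟩ := hK.exists_thickening_subset_open
    (isOpen_setOfPred_eventually_nhds (p := fun w => χ w = 1)) hχK
  obtain ⟨C, hC, herr⟩ := hP.exists_norm_inv_mul_cutoffError_le hbound hc n hχ hχc hχU hK hKU hd
    fun z hz w hwz => hdK (Metric.mem_thickening_iff.2 ⟨z, hz, by rwa [dist_eq_norm]⟩)
  refine ⟨c * d ^ 2 / 4, by positivity, C * √(area.real (tsupport χ)) + 1, by positivity,
    fun m hm u hu hui z hz => ?_⟩
  have hidentity := hP.factorial_mul_sub_integral_eq n m hu hχ hχc hχU (hKU hz)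
  rw [(hχK z hz).eq_of_nhds, Pi.one_apply, mul_one] at hidentity
  set N := √(∫ w in Metric.ball z₀ r, ‖u w‖ ^ 2 * Real.exp (-m * Q w) ∂area)
  set T := Real.exp (m * Q z / 2 - c * d ^ 2 / 4 * m)
  have hfactorial : (1 : ℝ) ≤ n ! := by exact_mod_cast n.factorial_pos
  refine (le_mul_of_one_le_left (norm_nonneg _) hfactorial).trans ?_
  rw [← Complex.norm_natCast, ← norm_mul, hidentity, norm_neg]
  calc _ ≤ C * T * (N * √(area.real (tsupport χ))) :=
        hP.norm_integral_mul_cutoffError_le n hu.1 hui hχc hχU (by positivity) (herr m hm z hz)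
    _ = C * √(area.real (tsupport χ)) * N * T := by ring
    _ ≤ (C * √(area.real (tsupport χ)) + 1) * N * T := by
        gcongr
        exact le_add_of_nonneg_right zero_le_one

end IsPolarization

/-! ### Cut-off functions -/

namespace IsCutoff

variable {χ₀ : ℝ → ℝ} {r : ℝ} {z₀ w : ℂ}

lemma eventuallyEq_one (h : IsCutoff χ₀) (hr : 0 < r) (hw : ‖w - z₀‖ < 2 / 3 * r) :
    (fun w : ℂ => (χ₀ (‖w - z₀‖ / r) : ℂ)) =ᶠ[𝓝 w] 1 := by
  filter_upwards [Metric.isOpen_ball.mem_nhds (mem_ball_iff_norm.2 hw)] with η hη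
  have hlt : ‖η - z₀‖ / r < 2 / 3 := (div_lt_iff₀ hr).2 (mem_ball_iff_norm.1 hη)
  have hnonneg : 0 ≤ ‖η - z₀‖ / r := by positivity
  simp [h.eq_one _ ⟨by linarith, hlt⟩]

lemma contDiff (h : IsCutoff χ₀) (hr : 0 < r) (z₀ : ℂ) :
    ContDiff ℝ ∞ fun w : ℂ => (χ₀ (‖w - z₀‖ / r) : ℂ) := by
  refine contDiff_iff_contDiffAt.2 fun w => ?_
  obtain rfl | hw := eq_or_ne w z₀
  · refine contDiffAt_const.congr_of_eventuallyEq (h.eventuallyEq_one hr ?_)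
    rw [sub_self, norm_zero]
    positivity
  · have hnorm : ContDiffAt ℝ ∞ (fun w : ℂ => ‖w - z₀‖ / r) w :=
      ((contDiffAt_id.sub contDiffAt_const).norm ℝ (sub_ne_zero.2 hw)).div_const r
    exact Complex.ofRealCLM.contDiff.contDiffAt.comp w (h.smooth.contDiffAt.comp w hnorm)

lemma tsupport_subset_ball (h : IsCutoff χ₀) (hr : 0 < r) (z₀ : ℂ) :
    (tsupport fun w : ℂ => (χ₀ (‖w - z₀‖ / r) : ℂ)) ⊆ Metric.ball z₀ r := by
  have hcont : Continuous fun w : ℂ => ‖w - z₀‖ / r := by fun_prop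
  have hpre : (tsupport fun w : ℂ => (χ₀ (‖w - z₀‖ / r) : ℂ)) ⊆
      (fun w => ‖w - z₀‖ / r) ⁻¹' tsupport χ₀ :=
    closure_minimal (fun w hw => subset_tsupport χ₀ (by simpa using hw))
      ((isClosed_tsupport χ₀).preimage hcont)
  intro w hw
  rw [mem_ball_iff_norm, ← div_lt_one hr]
  exact (h.support (hpre hw)).2

lemma hasCompactSupport (h : IsCutoff χ₀) (hr : 0 < r) (z₀ : ℂ) :
    HasCompactSupport fun w : ℂ => (χ₀ (‖w - z₀‖ / r) : ℂ) :=
  HasCompactSupport.of_support_subset_isCompact (isCompact_closedBall z₀ r)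
    ((subset_tsupport _).trans ((h.tsupport_subset_ball hr z₀).trans Metric.ball_subset_closedBall))

end IsCutoff

/-! ### Complexification of real-analytic functions -/

/-- The coordinate `(a + b) / 2` on `ℂ²`, which continues `re w` holomorphically from the
totally real plane `{(w, w̄)}`. -/
def reExt : ℂ × ℂ →L[ℂ] ℂ :=
  (1 / 2 : ℂ) • (ContinuousLinearMap.fst ℂ ℂ ℂ + ContinuousLinearMap.snd ℂ ℂ ℂ)

/-- The coordinate `(a - b) / 2i` on `ℂ²`, which continues `im w` holomorphically from the
totally real plane `{(w, w̄)}`. -/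
def imExt : ℂ × ℂ →L[ℂ] ℂ :=
  (1 / (2 * Complex.I)) • (ContinuousLinearMap.fst ℂ ℂ ℂ - ContinuousLinearMap.snd ℂ ℂ ℂ)

lemma reExt_apply (v : ℂ × ℂ) : reExt v = (v.1 + v.2) / 2 := by
  simp only [reExt, smul_apply, add_apply, ContinuousLinearMap.coe_fst',
    ContinuousLinearMap.coe_snd', smul_eq_mul]
  ring

lemma imExt_apply (v : ℂ × ℂ) : imExt v = (v.1 - v.2) / (2 * Complex.I) := by
  simp only [imExt, smul_apply, sub_apply, ContinuousLinearMap.coe_fst',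
    ContinuousLinearMap.coe_snd', smul_eq_mul]
  ring

lemma reExt_conj (w : ℂ) : reExt (w, conj w) = w.re := by
  rw [reExt_apply, Complex.re_eq_add_conj]

lemma imExt_conj (w : ℂ) : imExt (w, conj w) = w.im := by
  rw [imExt_apply, Complex.im_eq_sub_conj]

lemma conj_reExt (a b : ℂ) : conj (reExt (a, b)) = reExt (conj b, conj a) := by
  simp only [reExt_apply, map_div₀, map_add, Complex.conj_ofNat]
  rw [add_comm]

lemma conj_imExt (a b : ℂ) : conj (imExt (a, b)) = imExt (conj b, conj a) := by
  simp only [imExt_apply, map_div₀, map_sub, map_mul, Complex.conj_I, Complex.conj_ofNat]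
  rw [mul_neg, div_neg, ← neg_div, neg_sub]

lemma norm_reExt_le : ‖reExt‖ ≤ 1 := by
  refine ContinuousLinearMap.opNorm_le_bound _ zero_le_one fun v => ?_
  rw [reExt_apply, norm_div, Complex.norm_ofNat, one_mul, div_le_iff₀ two_pos]
  linarith [norm_add_le v.1 v.2, norm_fst_le v, norm_snd_le v]

lemma norm_imExt_le : ‖imExt‖ ≤ 1 := by
  refine ContinuousLinearMap.opNorm_le_bound _ zero_le_one fun v => ?_
  rw [imExt_apply, norm_div, norm_mul, Complex.norm_I, Complex.norm_ofNat, one_mul, mul_one,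
    div_le_iff₀ two_pos]
  linarith [norm_sub_le v.1 v.2, norm_fst_le v, norm_snd_le v]

section Complexify

variable {n : ℕ}

/-- The monomial form `∏ i, x i` on `(ℂ²)ⁿ`, where `x i` is `reExt` for `i ∈ s` and `imExt`
otherwise. -/
def coordMonomial (s : Finset (Fin n)) :
    ContinuousMultilinearMap ℂ (fun _ : Fin n => ℂ × ℂ) ℂ :=
  (ContinuousMultilinearMap.mkPiAlgebra ℂ (Fin n) ℂ).compContinuousLinearMap
    fun i => if i ∈ s then reExt else imExt

lemma coordMonomial_apply (s : Finset (Fin n)) (v : Fin n → ℂ × ℂ) :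
    coordMonomial s v = ∏ i, if i ∈ s then reExt (v i) else imExt (v i) := by
  simp only [coordMonomial, ContinuousMultilinearMap.compContinuousLinearMap_apply,
    ContinuousMultilinearMap.mkPiAlgebra_apply]
  exact Finset.prod_congr rfl fun i _ => by split_ifs <;> rfl

lemma coordMonomial_conj (s : Finset (Fin n)) (w : ℂ) :
    coordMonomial s (fun _ => (w, conj w)) = ((∏ i, if i ∈ s then w.re else w.im : ℝ) : ℂ) := by
  simp only [coordMonomial_apply, reExt_conj, imExt_conj, Complex.ofReal_prod,
    apply_ite (fun x : ℝ => (x : ℂ))]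

lemma conj_coordMonomial (s : Finset (Fin n)) (a b : ℂ) :
    conj (coordMonomial s fun _ => (a, b)) = coordMonomial s fun _ => (conj b, conj a) := by
  simp only [coordMonomial_apply, map_prod, apply_ite conj, conj_reExt, conj_imExt]

lemma norm_coordMonomial_le (s : Finset (Fin n)) : ‖coordMonomial s‖ ≤ 1 := by
  refine (ContinuousMultilinearMap.norm_compContinuousLinearMap_le _ _).trans ?_
  rw [ContinuousMultilinearMap.norm_mkPiAlgebra, one_mul]
  refine Finset.prod_le_one (fun _ _ => norm_nonneg _) fun i _ => ?_
  split_ifs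
  exacts [norm_reExt_le, norm_imExt_le]

/-- The holomorphic continuation of a real multilinear form on `ℂ`, from the totally real plane
`{(w, w̄)}` to `ℂ²`: the form is expanded in the basis `1`, `i` and the real and imaginary parts
of its arguments are replaced by `reExt` and `imExt`. -/
def complexify (T : ContinuousMultilinearMap ℝ (fun _ : Fin n => ℂ) ℝ) :
    ContinuousMultilinearMap ℂ (fun _ : Fin n => ℂ × ℂ) ℂ :=
  ∑ s : Finset (Fin n), ((T fun i => if i ∈ s then 1 else Complex.I : ℝ) : ℂ) • coordMonomial s

variable (T : ContinuousMultilinearMap ℝ (fun _ : Fin n => ℂ) ℝ)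

lemma complexify_apply (v : Fin n → ℂ × ℂ) : complexify T v = ∑ s : Finset (Fin n),
    ((T fun i => if i ∈ s then 1 else Complex.I : ℝ) : ℂ) * coordMonomial s v := by
  simp only [complexify, sum_apply, smul_apply, smul_eq_mul]

lemma map_diag_eq_sum_re_im (w : ℂ) : (T fun _ => w) = ∑ s : Finset (Fin n),
    (T fun i => if i ∈ s then 1 else Complex.I) * ∏ i, if i ∈ s then w.re else w.im := by
  have hw : (fun _ : Fin n => w) = (fun _ => w.re • (1 : ℂ)) + fun _ => w.im • Complex.I := by
    ext1
    simp
  conv_lhs => rw [hw]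
  rw [T.map_add_univ]
  refine Finset.sum_congr rfl fun s _ => ?_
  rw [mul_comm, ← smul_eq_mul, ← T.map_smul_univ]
  congr 1
  ext1 i
  by_cases hi : i ∈ s <;> simp [hi]

lemma complexify_conj (w : ℂ) : complexify T (fun _ => (w, conj w)) = (T fun _ => w : ℝ) := by
  simp only [complexify_apply, coordMonomial_conj, map_diag_eq_sum_re_im T w, Complex.ofReal_sum,
    Complex.ofReal_mul]

lemma conj_complexify (a b : ℂ) :
    conj (complexify T fun _ => (a, b)) = complexify T fun _ => (conj b, conj a) := by
  simp only [complexify_apply, map_sum, map_mul, Complex.conj_ofReal, conj_coordMonomial]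

lemma norm_complexify_le : ‖complexify T‖ ≤ 2 ^ n * ‖T‖ := by
  have hterm : ∀ s ∈ (Finset.univ : Finset (Finset (Fin n))),
      ‖((T fun i => if i ∈ s then 1 else Complex.I : ℝ) : ℂ) • coordMonomial s‖ ≤ ‖T‖ := by
    intro s _
    have hT : ‖T fun i => if i ∈ s then 1 else Complex.I‖ ≤ ‖T‖ := by
      refine (T.le_opNorm _).trans_eq ?_
      rw [Finset.prod_eq_one, mul_one]
      intro i _
      split_ifs <;> simp
    rw [norm_smul, Complex.norm_real]
    exact (mul_le_mul hT (norm_coordMonomial_le s) (norm_nonneg _) (norm_nonneg _)).trans_eq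
      (mul_one _)
  refine (norm_sum_le_of_le _ hterm).trans_eq ?_
  simp [Finset.card_univ]

end Complexify

/-- The coefficientwise complexification of a real power series. -/
def complexifySeries (p : FormalMultilinearSeries ℝ ℂ ℝ) : FormalMultilinearSeries ℂ (ℂ × ℂ) ℂ :=
  fun n => complexify (p n)

lemma complexifySeries_radius_pos {p : FormalMultilinearSeries ℝ ℂ ℝ} (hp : 0 < p.radius) :
    0 < (complexifySeries p).radius := by
  obtain ⟨s, hs0, hs⟩ := ENNReal.lt_iff_exists_nnreal_btwn.1 hp
  have hs0' : 0 < s / 2 := half_pos (by exact_mod_cast hs0)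
  refine lt_of_lt_of_le (by exact_mod_cast hs0') (FormalMultilinearSeries.le_radius_of_summable _
    ((p.summable_norm_mul_pow hs).of_nonneg_of_le (fun n => by positivity) fun n => ?_))
  refine (mul_le_mul_of_nonneg_right (norm_complexify_le (p n)) (by positivity)).trans_eq ?_
  push_cast
  rw [div_pow]
  field_simp

lemma conj_complexifySeries_sum (p : FormalMultilinearSeries ℝ ℂ ℝ) (a b : ℂ) :
    conj ((complexifySeries p).sum (a, b)) = (complexifySeries p).sum (conj b, conj a) := by
  simp only [FormalMultilinearSeries.sum, Complex.conj_tsum, complexifySeries, conj_complexify]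

lemma complexifySeries_sum_conj (p : FormalMultilinearSeries ℝ ℂ ℝ) (w : ℂ) :
    (complexifySeries p).sum (w, conj w) = (p.sum w : ℂ) := by
  simp only [FormalMultilinearSeries.sum, Complex.ofReal_tsum, complexifySeries, complexify_conj]

lemma exists_holomorphic_extension {Q : ℂ → ℝ} {z₀ : ℂ} (han : AnalyticAt ℝ Q z₀) :
    ∃ p : ℂ × ℂ → ℂ, AnalyticAt ℂ p (z₀, conj z₀) ∧ (∀ᶠ w in 𝓝 z₀, p (w, conj w) = Q w) ∧
      ∀ a b, conj (p (a, b)) = p (conj b, conj a) := by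
  obtain ⟨T, R, hT⟩ := han
  refine ⟨fun x => (complexifySeries T).sum (x - (z₀, conj z₀)), ?_, ?_, fun a b => ?_⟩
  · have hsum : AnalyticAt ℂ (complexifySeries T).sum ((z₀, conj z₀) - (z₀, conj z₀)) := by
      rw [sub_self]
      exact ((complexifySeries T).hasFPowerSeriesOnBall
        (complexifySeries_radius_pos (hT.r_pos.trans_le hT.r_le))).analyticAt
    exact hsum.comp (f := fun x => x - (z₀, conj z₀)) (analyticAt_id.sub analyticAt_const)
  · filter_upwards [Metric.eball_mem_nhds z₀ hT.r_pos] with w hw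
    have hw' : w - z₀ ∈ Metric.eball (0 : ℂ) R := by
      simpa only [Metric.mem_eball, edist_eq_enorm_sub, sub_zero] using hw
    rw [Prod.mk_sub_mk, ← map_sub, complexifySeries_sum_conj, ← hT.sum hw', add_sub_cancel]
  · simp only [Prod.mk_sub_mk, conj_complexifySeries_sum, map_sub, Complex.conj_conj]

/-! ### Small radii are admissible -/

section MixedDerivative

variable {𝕜 F : Type*} [RCLike 𝕜] [NormedAddCommGroup F] [NormedSpace 𝕜 F]

/-- The partial derivative of `p` in its second variable. -/
def derivSnd (p : 𝕜 × 𝕜 → F) (x : 𝕜 × 𝕜) : F := fderiv 𝕜 p x (0, 1)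

/-- The mixed second derivative of `p`, first in the second variable and then in the first. -/
def derivMixed (p : 𝕜 × 𝕜 → F) (x : 𝕜 × 𝕜) : F := fderiv 𝕜 (derivSnd p) x (1, 0)

variable {p : 𝕜 × 𝕜 → F} {a b : 𝕜}

lemma hasDerivAt_comp_prodMk_right (h : DifferentiableAt 𝕜 p (a, b)) :
    HasDerivAt (fun b => p (a, b)) (derivSnd p (a, b)) b :=
  h.hasFDerivAt.comp_hasDerivAt b ((hasDerivAt_const b a).prodMk (hasDerivAt_id b))

lemma hasDerivAt_derivSnd (h : DifferentiableAt 𝕜 (derivSnd p) (a, b)) :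
    HasDerivAt (fun a => derivSnd p (a, b)) (derivMixed p (a, b)) a :=
  HasFDerivAt.comp_hasDerivAt (f := fun a => (a, b)) a h.hasFDerivAt
    ((hasDerivAt_id a).prodMk (hasDerivAt_const a b))

section Analytic

variable [CompleteSpace F] {x : 𝕜 × 𝕜}

lemma analyticAt_derivSnd (h : AnalyticAt 𝕜 p x) : AnalyticAt 𝕜 (derivSnd p) x :=
  ((ContinuousLinearMap.apply 𝕜 F ((0, 1) : 𝕜 × 𝕜)).analyticAt _).comp h.fderiv

lemma analyticAt_derivMixed (h : AnalyticAt 𝕜 p x) : AnalyticAt 𝕜 (derivMixed p) x :=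
  ((ContinuousLinearMap.apply 𝕜 F ((1, 0) : 𝕜 × 𝕜)).analyticAt _).comp
    (analyticAt_derivSnd h).fderiv

variable {U V : Set 𝕜} {d : F} {η : ℝ} {a' b' : 𝕜}

lemma norm_derivSnd_sub_sub_smul_le (hU : Convex ℝ U) (hp : AnalyticOnNhd 𝕜 p (U ×ˢ V))
    (hd : ∀ x ∈ U ×ˢ V, ‖derivMixed p x - d‖ ≤ η) (ha : a ∈ U) (ha' : a' ∈ U) (hb : b ∈ V) :
    ‖derivSnd p (a, b) - derivSnd p (a', b) - (a - a') • d‖ ≤ η * ‖a - a'‖ := by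
  have hmvt := hU.norm_image_sub_le_of_norm_hasDerivWithin_le (𝕜 := 𝕜)
    (f := fun a => derivSnd p (a, b) - a • d) (f' := fun a => derivMixed p (a, b) - (1 : 𝕜) • d)
    (C := η) (fun x hx => ?_) (fun x hx => by simpa using hd (x, b) ⟨hx, hb⟩) ha' ha
  · refine (congrArg norm ?_).trans_le hmvt
    module
  · exact ((hasDerivAt_derivSnd (analyticAt_derivSnd (hp (x, b) ⟨hx, hb⟩)).differentiableAt).sub
      ((hasDerivAt_id x).smul_const d)).hasDerivWithinAt

lemma norm_second_difference_sub_smul_le (hU : Convex ℝ U) (hV : Convex ℝ V)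
    (hp : AnalyticOnNhd 𝕜 p (U ×ˢ V)) (hd : ∀ x ∈ U ×ˢ V, ‖derivMixed p x - d‖ ≤ η)
    (ha : a ∈ U) (ha' : a' ∈ U) (hb : b ∈ V) (hb' : b' ∈ V) :
    ‖p (a, b) - p (a', b) - p (a, b') + p (a', b') - ((a - a') * (b - b')) • d‖ ≤
      η * ‖a - a'‖ * ‖b - b'‖ := by
  have hmvt := hV.norm_image_sub_le_of_norm_hasDerivWithin_le (𝕜 := 𝕜)
    (f := fun b => p (a, b) - p (a', b) - b • (a - a') • d)
    (f' := fun b => derivSnd p (a, b) - derivSnd p (a', b) - (1 : 𝕜) • (a - a') • d)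
    (C := η * ‖a - a'‖) (fun y hy => ?_)
    (fun y hy => by simpa using norm_derivSnd_sub_sub_smul_le hU hp hd ha ha' hy) hb' hb
  · refine (congrArg norm ?_).trans_le hmvt
    module
  · have hsnd {x : 𝕜} (hx : x ∈ U) :=
      hasDerivAt_comp_prodMk_right (hp (x, y) ⟨hx, hy⟩).differentiableAt
    exact (((hsnd ha).sub (hsnd ha')).sub ((hasDerivAt_id y).smul_const _)).hasDerivWithinAt

end Analytic

end MixedDerivative

section Admissible

variable {Q : ℂ → ℝ} {z₀ z w d : ℂ} {r c : ℝ} {p : ℂ × ℂ → ℂ}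

lemma dz_eq_of_hasDerivAt {f : ℂ → ℂ} {f' : ℂ} (h : HasDerivAt f f' z) : dz f z = f' := by
  have hfst := h.comp_hasFDerivAt (z, conj z) (hasFDerivAt_fst (𝕜 := ℂ) (E := ℂ) (F := ℂ))
  refine (dz_comp_conj (Ψ := fun x => f x.1) hfst.differentiableAt).trans ?_
  exact (DFunLike.congr_fun hfst.fderiv _).trans (by simp)

lemma dbar_comp_prodMk_conj (h : DifferentiableAt ℂ p (z, conj w)) :
    dbar (fun η => p (z, conj η)) w = derivSnd p (z, conj w) := by
  have hconj : dbar (fun η => conj η) w = 1 := by simpa using dbar_conj_sub_const 0 w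
  rw [dbar_comp_of_hasDerivAt (f := fun η => conj η) (hasDerivAt_comp_prodMk_right h)
    (hasFDerivAt_conj w).differentiableAt, hconj, mul_one]

lemma dz_dbar_comp_conj (h : AnalyticAt ℂ p (z, conj w)) :
    dz (fun ζ => dbar (fun η => p (ζ, conj η)) w) z = derivMixed p (z, conj w) := by
  have hev : (fun ζ => dbar (fun η => p (ζ, conj η)) w) =ᶠ[𝓝 z]
      fun ζ => derivSnd p (ζ, conj w) := by
    have hslice : ContinuousAt (fun ζ : ℂ => (ζ, conj w)) z := by fun_prop
    filter_upwards [hslice.eventually h.eventually_analyticAt] with ζ hζ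
    exact dbar_comp_prodMk_conj hζ.differentiableAt
  rw [dz_congr hev, dz_eq_of_hasDerivAt (hasDerivAt_derivSnd
    (analyticAt_derivSnd h).differentiableAt)]

lemma lap_eq_re_derivMixed (hp : AnalyticAt ℂ p (z, conj z))
    (hdiag : ∀ᶠ w in 𝓝 z, p (w, conj w) = Q w) : lap Q z = (derivMixed p (z, conj z)).re := by
  have hcont : ContinuousAt (fun w : ℂ => (w, conj w)) z := by fun_prop
  have hev : dbar (fun w => (Q w : ℂ)) =ᶠ[𝓝 z] fun w => derivSnd p (w, conj w) := by
    filter_upwards [hcont.eventually hp.eventually_analyticAt, hdiag.eventually_nhds] with w hw hw'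
    rw [← dbar_congr hw']
    exact dbar_comp_conj hw.differentiableAt
  rw [lap, dz_congr hev, dz_comp_conj (analyticAt_derivSnd hp).differentiableAt, derivMixed]

lemma half_le_re_of_norm_sub_le (h : ‖w - d‖ ≤ c / 2) (hd : d.re = c) : c / 2 ≤ w.re := by
  have := (abs_le.1 ((Complex.abs_re_le_norm (w - d)).trans h)).1
  rw [Complex.sub_re, hd] at this
  linarith

lemma isPolarization_of_holomorphic
    (hp : AnalyticOnNhd ℂ p (Metric.ball z₀ r ×ˢ Metric.ball (conj z₀) r))
    (hdiag : ∀ w ∈ Metric.ball z₀ r, p (w, conj w) = Q w) :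
    IsPolarization Q z₀ r fun z w => p (z, conj w) :=
  ⟨by simpa only [Complex.conj_conj] using hp, hdiag⟩

lemma sub_mul_dbar_phase
    (hp : AnalyticOnNhd ℂ p (Metric.ball z₀ r ×ˢ Metric.ball (conj z₀) r))
    (hdiag : ∀ w ∈ Metric.ball z₀ r, p (w, conj w) = Q w) (hz : z ∈ Metric.ball z₀ r)
    (hw : w ∈ Metric.ball z₀ r) :
    (w - z) * dbar (phase Q (fun z w => p (z, conj w)) z) w =
      derivSnd p (w, conj w) - derivSnd p (z, conj w) := by
  have hP := isPolarization_of_holomorphic hp hdiag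
  have hphase : DifferentiableAt ℝ (phase Q (fun z w => p (z, conj w)) z) w :=
    (hP.isTriholomorphicOn_phase.analyticAt_right Metric.isOpen_ball hz hw).differentiableAt
  have hlin : DifferentiableAt ℂ (fun η => z - η) w := by fun_prop
  have hpw := (hp (w, conj w) ⟨hw, conj_mem_ball hw⟩).differentiableAt
  have hpz := hasDerivAt_comp_prodMk_right (hp (z, conj w) ⟨hz, conj_mem_ball hw⟩).differentiableAt
  have hΨ := (hpz.comp_hasFDerivAt (w, conj w) (hasFDerivAt_snd (𝕜 := ℂ) (E := ℂ) (F := ℂ))).sub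
    hpw.hasFDerivAt
  have hev : (fun η => (z - η) * phase Q (fun z w => p (z, conj w)) z η) =ᶠ[𝓝 w]
      fun η => p (z, conj η) - p (η, conj η) := by
    filter_upwards [Metric.isOpen_ball.mem_nhds hw] with η hη
    rw [sub_mul_phase (hP.diag z hz), hdiag η hη]
  have hdbar := dbar_congr hev
  rw [dbar_mul (hlin.restrictScalars ℝ) hphase, dbar_eq_zero_of_differentiableAt hlin, zero_mul,
    zero_add, dbar_comp_conj (Ψ := fun x => p (z, x.2) - p x) hΨ.differentiableAt] at hdbar
  have hfderiv : fderiv ℂ (fun x => p (z, x.2) - p x) (w, conj w) (0, 1) =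
      derivSnd p (z, conj w) - derivSnd p (w, conj w) :=
    (DFunLike.congr_fun hΨ.fderiv _).trans (by simp [derivSnd])
  linear_combination -(hdbar.trans hfderiv)

lemma norm_dbar_phase_sub_le
    (hp : AnalyticOnNhd ℂ p (Metric.ball z₀ r ×ˢ Metric.ball (conj z₀) r))
    (hdiag : ∀ w ∈ Metric.ball z₀ r, p (w, conj w) = Q w)
    (hd : ∀ x ∈ Metric.ball z₀ r ×ˢ Metric.ball (conj z₀) r, ‖derivMixed p x - d‖ ≤ c)
    (hz : z ∈ Metric.ball z₀ r) (hw : w ∈ Metric.ball z₀ r) :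
    ‖dbar (phase Q (fun z w => p (z, conj w)) z) w - d‖ ≤ c := by
  have hball : IsOpen (Metric.ball z₀ r) := Metric.isOpen_ball
  have off_diag : ∀ w ∈ Metric.ball z₀ r, w ≠ z →
      ‖dbar (phase Q (fun z w => p (z, conj w)) z) w - d‖ ≤ c := by
    intro w hw hwz
    have hmvt := norm_derivSnd_sub_sub_smul_le (convex_ball z₀ r) hp hd hw hz (conj_mem_ball hw)
    rw [← sub_mul_dbar_phase hp hdiag hz hw, smul_eq_mul, ← mul_sub, norm_mul, mul_comm] at hmvt
    exact le_of_mul_le_mul_right hmvt (norm_pos_iff.2 (sub_ne_zero.2 hwz))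
  obtain rfl | hwz := eq_or_ne w z
  · have hcont : ContinuousAt (dbar (phase Q (fun z w => p (z, conj w)) w)) w :=
      (((isPolarization_of_holomorphic hp hdiag).isTriholomorphicOn_phase.dbar_right
        hball).analyticAt_right hball hw hw).continuousAt
    refine le_of_tendsto ((hcont.tendsto.sub_const d).norm.mono_left
      (nhdsWithin_le_nhds (s := {w}ᶜ))) ?_
    filter_upwards [self_mem_nhdsWithin, mem_nhdsWithin_of_mem_nhds (hball.mem_nhds hw)]
      with η hne hη using off_diag η hη hne
  · exact off_diag w hw hwz

lemma two_mul_re_sub_sub_le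
    (hp : AnalyticOnNhd ℂ p (Metric.ball z₀ r ×ˢ Metric.ball (conj z₀) r))
    (hdiag : ∀ w ∈ Metric.ball z₀ r, p (w, conj w) = Q w)
    (hsymm : ∀ a b, conj (p (a, b)) = p (conj b, conj a))
    (hd : ∀ x ∈ Metric.ball z₀ r ×ˢ Metric.ball (conj z₀) r, ‖derivMixed p x - d‖ ≤ c)
    (hz : z ∈ Metric.ball z₀ r) (hw : w ∈ Metric.ball z₀ r) :
    2 * (p (z, conj w)).re - Q w - Q z ≤ (c - d.re) * ‖w - z‖ ^ 2 := by
  have hdiff := norm_second_difference_sub_smul_le (convex_ball z₀ r) (convex_ball (conj z₀) r) hp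
    hd hz hw (conj_mem_ball hz) (conj_mem_ball hw)
  rw [← map_sub, Complex.norm_conj, Complex.mul_conj, hdiag z hz, hdiag w hw, smul_eq_mul] at hdiff
  have hre := (abs_le.1 ((Complex.abs_re_le_norm _).trans hdiff)).1
  have hswap : (p (w, conj z)).re = (p (z, conj w)).re := by
    rw [← Complex.conj_re, hsymm, Complex.conj_conj]
  simp only [Complex.sub_re, Complex.add_re, Complex.re_ofReal_mul, Complex.ofReal_re, hswap,
    Complex.normSq_eq_norm_sq] at hre
  rw [norm_sub_rev w z]
  linarith

lemma isAdmissible_of_holomorphic (hr : 0 < r) (hpos : 0 < lap Q z₀)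
    (hQ : AnalyticOnNhd ℝ Q (Metric.ball z₀ r))
    (hp : AnalyticOnNhd ℂ p (Metric.ball z₀ r ×ˢ Metric.ball (conj z₀) r))
    (hdiag : ∀ w ∈ Metric.ball z₀ r, p (w, conj w) = Q w)
    (hsymm : ∀ a b, conj (p (a, b)) = p (conj b, conj a))
    (hd : ∀ x ∈ Metric.ball z₀ r ×ˢ Metric.ball (conj z₀) r,
      ‖derivMixed p x - derivMixed p (z₀, conj z₀)‖ ≤ lap Q z₀ / 2) :
    IsAdmissible Q z₀ r fun z w => p (z, conj w) := by
  have hlap {z : ℂ} (hz : z ∈ Metric.ball z₀ r) : lap Q z = (derivMixed p (z, conj z)).re :=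
    lap_eq_re_derivMixed (hp _ ⟨hz, conj_mem_ball hz⟩)
      (eventually_of_mem (Metric.isOpen_ball.mem_nhds hz) hdiag)
  have hre := (hlap (Metric.mem_ball_self hr)).symm
  have ne_zero {x : ℂ} (hx : ‖x - derivMixed p (z₀, conj z₀)‖ ≤ lap Q z₀ / 2) : x ≠ 0 := by
    rintro rfl
    have := half_le_re_of_norm_sub_le hx hre
    rw [Complex.zero_re] at this
    linarith
  refine ⟨hr, hQ, ⟨lap Q z₀ / 4, by positivity, fun z hz => ?_⟩,
    isPolarization_of_holomorphic hp hdiag, fun z hz w hw => ?_,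
    fun z hz w hw => ne_zero (norm_dbar_phase_sub_le hp hdiag hd hz hw), fun z hz w hw => ?_⟩
  · rw [hlap hz]
    linarith [half_le_re_of_norm_sub_le (hd (z, conj z) ⟨hz, conj_mem_ball hz⟩) hre]
  · rw [dz_dbar_comp_conj (hp _ ⟨hz, conj_mem_ball hw⟩)]
    exact ne_zero (hd _ ⟨hz, conj_mem_ball hw⟩)
  · refine (two_mul_re_sub_sub_le hp hdiag hsymm hd hz hw).trans_eq ?_
    rw [hre]
    ring

theorem exists_isAdmissible (han : AnalyticAt ℝ Q z₀) (hpos : 0 < lap Q z₀) :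
    ∃ r₀ : ℝ, 0 < r₀ ∧ ∀ r : ℝ, 0 < r → r ≤ r₀ → ∃ P : ℂ → ℂ → ℂ, IsAdmissible Q z₀ r P := by
  obtain ⟨p, hp, hdiag, hsymm⟩ := exists_holomorphic_extension han
  have hd : ∀ᶠ x in 𝓝 (z₀, conj z₀),
      ‖derivMixed p x - derivMixed p (z₀, conj z₀)‖ ≤ lap Q z₀ / 2 := by
    filter_upwards [(analyticAt_derivMixed hp).continuousAt.eventually
      (Metric.closedBall_mem_nhds _ (half_pos hpos))] with x hx
    exact mem_closedBall_iff_norm.1 hx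
  obtain ⟨r₁, hr₁, h₁⟩ := Metric.eventually_nhds_iff_ball.1 (hp.eventually_analyticAt.and hd)
  obtain ⟨r₂, hr₂, h₂⟩ := Metric.eventually_nhds_iff_ball.1 (han.eventually_analyticAt.and hdiag)
  simp only [← ball_prod_same] at h₁
  refine ⟨min r₁ r₂, lt_min hr₁ hr₂, fun r hr hle => ?_⟩
  have sub₁ := prod_mono (Metric.ball_subset_ball (x := z₀) (hle.trans (min_le_left r₁ r₂)))
    (Metric.ball_subset_ball (x := conj z₀) (hle.trans (min_le_left r₁ r₂)))
  have sub₂ := Metric.ball_subset_ball (x := z₀) (hle.trans (min_le_right r₁ r₂))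
  exact ⟨_, isAdmissible_of_holomorphic hr hpos (fun w hw => (h₂ w (sub₂ hw)).1)
    (fun x hx => (h₁ x (sub₁ hx)).1) (fun w hw => (h₂ w (sub₂ hw)).2) hsymm
    fun x hx => (h₁ x (sub₁ hx)).2⟩

end Admissible

lemma IsPolyanalyticOn.mono {q : ℕ} {f : ℂ → ℂ} {U V : Set ℂ} (hf : IsPolyanalyticOn q f U)
    (hVU : V ⊆ U) : IsPolyanalyticOn q f V :=
  ⟨hf.1.mono hVU, fun g hg hgc hgV => hf.2 g hg hgc (hgV.trans hVU)⟩

lemma MemA2.sqrt_setIntegral_le_wnorm {q : ℕ} {m : ℝ} {Q : ℂ → ℝ} {u : ℂ → ℂ}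
    (hu : MemA2 q m Q u) (s : Set ℂ) :
    √(∫ w in s, ‖u w‖ ^ 2 * Real.exp (-m * Q w) ∂area) ≤ wnorm m Q u :=
  Real.sqrt_le_sqrt (setIntegral_le_integral hu.2 (.of_forall fun w => by positivity))

end Polyanalytic

end

theorem mainTheorem5_general (Q : ℂ → ℝ) (z₀ : ℂ) :
    (AnalyticAt ℝ Q z₀ → 0 < Polyanalytic.lap Q z₀ →
      ∃ r₀ : ℝ, 0 < r₀ ∧ ∀ r : ℝ, 0 < r → r ≤ r₀ →
        ∃ P : ℂ → ℂ → ℂ, Polyanalytic.IsAdmissible Q z₀ r P) ∧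
    ∀ (r c : ℝ) (P : ℂ → ℂ → ℂ), Polyanalytic.IsPolarization Q z₀ r P → 0 < c →
      (∀ z ∈ Metric.ball z₀ r, ∀ w ∈ Metric.ball z₀ r,
        2 * (P z w).re - Q w - Q z ≤ -c * ‖w - z‖ ^ 2) →
      ∀ q : ℕ, 1 ≤ q →
        (∀ m : ℝ,
          (∀ w ∈ Metric.ball z₀ r, Polyanalytic.IsPolyanalyticOn q
            (fun z => Polyanalytic.kernelR q m Q P z w) (Metric.ball z₀ r)) ∧
          (∀ z ∈ Metric.ball z₀ r, AnalyticOnNhd ℝ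
            (fun w => Polyanalytic.kernelR q m Q P z w) (Metric.ball z₀ r))) ∧
        ∀ (χ : ℂ → ℂ) (K : Set ℂ), ContDiff ℝ ∞ χ → HasCompactSupport χ →
          tsupport χ ⊆ Metric.ball z₀ r → IsCompact K → (∀ z ∈ K, χ =ᶠ[nhds z] 1) →
          ∃ δ : ℝ, 0 < δ ∧ ∃ C : ℝ, 0 < C ∧ ∀ m : ℝ, 1 ≤ m → ∀ u : ℂ → ℂ,
            Polyanalytic.IsPolyanalyticOn q u (Metric.ball z₀ r) →
            IntegrableOn (fun w => ‖u w‖ ^ 2 * Real.exp (-m * Q w)) (Metric.ball z₀ r)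
              Polyanalytic.area →
            ∀ z ∈ K,
              IntegrableOn (fun w => u w * χ w * Polyanalytic.kernelR q m Q P z w *
                Polyanalytic.expPhase m Q P z w) (Metric.ball z₀ r) Polyanalytic.area ∧
              ‖u z - ∫ w in Metric.ball z₀ r, u w * χ w * Polyanalytic.kernelR q m Q P z w *
                  Polyanalytic.expPhase m Q P z w ∂Polyanalytic.area‖ ≤
                C * √(∫ w in Metric.ball z₀ r,
                    ‖u w‖ ^ 2 * Real.exp (-m * Q w) ∂Polyanalytic.area) *
                  Real.exp (m * Q z / 2 - δ * m) := by
  refine ⟨Polyanalytic.exists_isAdmissible, fun r c P hP hc hbound q hq =>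
    ⟨fun m => ⟨fun w hw => hP.isPolyanalyticOn_kernelR q m hw,
      fun z hz => hP.analyticOnNhd_kernelR q m hz⟩, fun χ K hχ hχc hχU hK hχK => ?_⟩⟩
  obtain ⟨n, rfl⟩ := Nat.exists_eq_add_of_le' hq
  obtain ⟨δ, hδ, C, hC, hest⟩ := hP.exists_norm_sub_integral_le hbound hc n hχ hχc hχU hK hχK
  refine ⟨δ, hδ, C, hC, fun m hm u hu hui z hz => ⟨?_, hest m hm u hu hui z hz⟩⟩
  have hzχ : z ∈ tsupport χ := subset_tsupport χ (by simp [(hχK z hz).eq_of_nhds])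
  exact (hP.integrable_mul_kernelR hu.1 hχ.continuous hχc hχU (n + 1) m (hχU hzχ)).integrableOn

theorem mainTheorem5 (Q : ℂ → ℝ) (hQ : Continuous Q) (z₀ : ℂ)
    (han : AnalyticAt ℝ Q z₀) (hpos : 0 < Polyanalytic.lap Q z₀) :
    -- all sufficiently small radii are admissible
    (∃ r₀ : ℝ, 0 < r₀ ∧ ∀ r : ℝ, 0 < r → r ≤ r₀ →
      ∃ P : ℂ → ℂ → ℂ, Polyanalytic.IsAdmissible Q z₀ r P) ∧
    ∀ (r : ℝ) (P : ℂ → ℂ → ℂ), Polyanalytic.IsAdmissible Q z₀ r P →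
      ∀ q : ℕ, 1 ≤ q →
        -- the kernel is `q`-analytic in the first variable and real-analytic in the second
        (∀ m : ℝ, 1 ≤ m →
          (∀ w ∈ Metric.ball z₀ r,
            Polyanalytic.IsPolyanalyticOn q (fun z => Polyanalytic.kernelR q m Q P z w)
              (Metric.ball z₀ r)) ∧
          (∀ z ∈ Metric.ball z₀ r,
            AnalyticOnNhd ℝ (fun w => Polyanalytic.kernelR q m Q P z w)
              (Metric.ball z₀ r))) ∧
        -- the approximate reproducing identity
        ∀ χ₀ : ℝ → ℝ, Polyanalytic.IsCutoff χ₀ →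
          ∃ δ : ℝ, 0 < δ ∧ ∃ C : ℝ, 0 < C ∧ ∀ m : ℝ, 1 ≤ m → ∀ u : ℂ → ℂ, Polyanalytic.MemA2 q m Q u →
            ∀ z ∈ Metric.ball z₀ (r / 3),
              MeasureTheory.IntegrableOn
                (fun w => u w * (χ₀ (‖w - z₀‖ / r) : ℂ) * Polyanalytic.kernelR q m Q P z w *
                  Polyanalytic.expPhase m Q P z w)
                (Metric.ball z₀ r) Polyanalytic.area ∧
              ‖u z - ∫ w in Metric.ball z₀ r,
                  u w * (χ₀ (‖w - z₀‖ / r) : ℂ) * Polyanalytic.kernelR q m Q P z w *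
                    Polyanalytic.expPhase m Q P z w ∂Polyanalytic.area‖
                ≤ C * Polyanalytic.wnorm m Q u * Real.exp (m * Q z / 2 - δ * m) := by
  obtain ⟨hexists, hgeneral⟩ := mainTheorem5_general Q z₀
  refine ⟨hexists han hpos, fun r P hA q hq => ?_⟩
  obtain ⟨hkernel, hestimate⟩ := hgeneral r (1 / 2 * Polyanalytic.lap Q z₀) P hA.polar
    (by positivity) (by simpa only [neg_mul] using hA.bound) q hq
  refine ⟨fun m _ => hkernel m, fun χ₀ hχ₀ => ?_⟩
  have hr := hA.pos
  obtain ⟨δ, hδ, C, hC, hest⟩ := hestimate _ (Metric.closedBall z₀ (r / 3))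
    (hχ₀.contDiff hr z₀) (hχ₀.hasCompactSupport hr z₀) (hχ₀.tsupport_subset_ball hr z₀)
    (isCompact_closedBall z₀ _)
    fun z hz => hχ₀.eventuallyEq_one hr (by linarith [mem_closedBall_iff_norm.1 hz])
  refine ⟨δ, hδ, C, hC, fun m hm u hu z hz => ?_⟩
  obtain ⟨hint, hle⟩ := hest m hm u (hu.1.mono (subset_univ _)) hu.2.integrableOn z
    (Metric.ball_subset_closedBall hz)
  refine ⟨hint, hle.trans ?_⟩
  gcongr
  exact hu.sqrt_setIntegral_le_wnorm _
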